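/- Let $A\in\mathbb Z^{m\times n}$ with $\operatorname{rank}A=m$, $n\ge 1$, $b\in\mathbb Z^m$, $c\in\mathbb Z^n$, and consider the linear optimization problem $(A,b,c)$: $\min c^Tx$ s.t. $Ax=b$, $x\ge 0$, with dual $\max b^Ty$ s.t. $A^Ty+s=c$, $s\ge 0$. Let $$L=mn+m+n+\sum_{i,j}\lceil\log_2(|a_{ij}|+1)\rceil+\sum_j\lceil\log_2(|c_j|+1)\rceil+\sum_i\lceil\log_2(|b_i|+1)\rceil .$$ Let $\mathcal{PD}^*$ be the set of all $(x,y,s)$ with $Ax=b$, $A^Ty+s=c$, $x,s\ge0$, $x^Ts=0$, and let $\mathcal B=\{j: x^*_j>0\text{ for some }(x^*,y^*,s^*)\in\mathcal{PD}^*\}$, $\mathcal N=\{j: s^*_j>0\text{ for some }(x^*,y^*,s^*)\in\mathcal{PD}^*\}$. For $s>0$, $\mu>0$ and $S=\operatorname{diag}(s)$, the exact Newton direction $(\Delta\hat s,\Delta y)$ at $(s,\mu)$ is the unique solution of $$\begin{bmatrix}S^2&A^T\\A&0\end{bmatrix}\begin{bmatrix}\Delta\hat s\\ \Delta y\end{bmatrix}=\begin{bmatrix}0\\-\frac1\mu\,(b-\mu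 AS^{-1}e)\end{bmatrix},$$ and $\Delta s=S^2\Delta\hat s$, $\delta(s,\mu)=\|S^{-1}\Delta s\|_2$, $x(s,\mu)=\mu S^{-1}(e-S^{-1}\Delta s)$. Algorithm (almost-exact dual logarithmic barrier method; input $y^0,s^0,\mu^0,\theta,t$). While $\mu^k>2^{-2L}$: compute any $(\Delta\hat s^k,\Delta y^k)$ that solves the Newton system at $(s^k,\mu^k)$ with precision $2^{-tL}$, i.e. the Euclidean distance to the exact solution is at most $2^{-tL}$, where in each iteration the distance may be measured either in the variables $(\Delta\hat s,\Delta y)$ or in the variables $(\Delta s,\Delta y)$; put $y^{k+1}=y^k+\Delta y^k$, $s^{k+1}=s^k+(S^k)^2\Delta\hat s^k$, $\mu^{k+1}=(1-\theta)\mu^k$. Let $\xi^{k+1}=(S^k)^2\Delta\hat s^k+A^T\Delta y^k$ be the resulting error in the dual equation and $r^k=\sum_{i=1}^k\xi^i$. Theorem. For every constant $\kappa\ge1$ there is a constant $C>0$ depending only on $\kappa$ such that the following holds for all real $t\ge 3\kappa+6$ (e.g. $t=9$ for $\kappa=1$) and all $A,b,c$ as above. Suppose that $A^Ty^0+s^0=c$,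 $2^{-\kappa L}\le s^0_i\le 2^{\kappa L}$ for all $i$, $0<\mu^0\le 2^{\kappa L}$, $\delta(s^0,\mu^0)<\frac12$, and $\frac1{4\kappa\sqrt n}\le\theta\le\frac1{4\sqrt n}$. Then for every run of the algorithm, whatever the errors within the stated precision: 1. The number of iterations is at most $C\sqrt n\,L$. 2. For every iterate $k$: the Newton system at $s^k$ is nonsingular, $\delta(s^k,\mu^k)<\frac12$, the triple $(x(s^k,\mu^k),y^k,s^k)$ is strictly feasible for the perturbed problem $(A,b,c+r^k)$, i.e. $Ax(s^k,\mu^k)=b$, $A^Ty^k+s^k=c+r^k$, $x(s^k,\mu^k)>0$, $s^k>0$, and $\|r^k\|_2\le 2^{(3\kappa+2-t)L}$. 3. At termination, after $K$ iterations, put $\tilde x=x(s^K,\mu^K)$. Then $\tilde x^Ts^K/n\le\frac32\,2^{-2L}$; rounding entries below $2^{-L}$ to zero identifies the optimal partition of $(A,b,c)$: $\{i:s^K_i<2^{-L}\}=\mathcal B$ and $\{i:\tilde x_i<2^{-L}\}=\mathcal N$; and solving the least squares problems $$\min\{\|x-\tilde x\|_2: Ax=b,\ x_i=0\text{ whenever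 }\tilde x_i<2^{-L}\},$$ $$\min\{\|s-s^K\|_2: A^Ty+s=c,\ s_i=0\text{ whenever }s^K_i<2^{-L}\}$$ yields an exact optimal solution of the original problem: both have solutions, and all solutions $x$ and $(y,s)$ satisfy $(x,y,s)\in\mathcal{PD}^*$. -/

import Mathlib

open Matrix

/-- The Euclidean norm of a real vector. -/
noncomputable def l2norm {ι : Type*} [Fintype ι] (v : ι → ℝ) : ℝ :=
  ‖(WithLp.toLp 2 v : EuclideanSpace ℝ ι)‖

/-- A linear optimization problem in standard form,
`min cᵀx` subject to `A x = b`, `x ≥ 0`, with the dual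
`max bᵀy` subject to `Aᵀy + s = c`, `s ≥ 0`. -/
structure LO (m n : ℕ) where
  A : Matrix (Fin m) (Fin n) ℝ
  b : Fin m → ℝ
  c : Fin n → ℝ

namespace LO

variable {m n : ℕ}

/-- Primal-dual feasible solutions `(x, y, s)`. -/
def feasibleSet (P : LO m n) : Set ((Fin n → ℝ) × (Fin m → ℝ) × (Fin n → ℝ)) :=
  {p | P.A *ᵥ p.1 = P.b ∧ P.Aᵀ *ᵥ p.2.1 + p.2.2 = P.c ∧ 0 ≤ p.1 ∧ 0 ≤ p.2.2}

/-- Strictly feasible (interior) primal-dual solutions. -/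
def interiorSet (P : LO m n) : Set ((Fin n → ℝ) × (Fin m → ℝ) × (Fin n → ℝ)) :=
  {p | p ∈ P.feasibleSet ∧ (∀ i, 0 < p.1 i) ∧ ∀ i, 0 < p.2.2 i}

/-- Primal-dual optimal solutions: feasible and complementary. -/
def optimalSet (P : LO m n) : Set ((Fin n → ℝ) × (Fin m → ℝ) × (Fin n → ℝ)) :=
  {p | p ∈ P.feasibleSet ∧ p.1 ⬝ᵥ p.2.2 = 0}

/-- `ζ`-optimal solutions: feasible with `xᵀs / n ≤ ζ`. -/
def approxOptimalSet (P : LO m n) (ζ : ℝ) :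
    Set ((Fin n → ℝ) × (Fin m → ℝ) × (Fin n → ℝ)) :=
  {p | p ∈ P.feasibleSet ∧ p.1 ⬝ᵥ p.2.2 / n ≤ ζ}

/-- The part `B` of the optimal partition. -/
def partitionB (P : LO m n) : Set (Fin n) := {j | ∃ p ∈ P.optimalSet, 0 < p.1 j}

/-- The part `N` of the optimal partition. -/
def partitionN (P : LO m n) : Set (Fin n) := {j | ∃ p ∈ P.optimalSet, 0 < p.2.2 j}

/-- The perturbed problem `(A, b, c + r)`. -/
def perturb (P : LO m n) (r : Fin n → ℝ) : LO m n := ⟨P.A, P.b, P.c + r⟩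

/-- The coefficient matrix `[S², Aᵀ; A, 0]` of the Newton system in the unknowns `(Δŝ, Δy)`. -/
def newtonMatrix (P : LO m n) (s : Fin n → ℝ) :
    Matrix (Fin n ⊕ Fin m) (Fin n ⊕ Fin m) ℝ :=
  Matrix.fromBlocks (Matrix.diagonal fun i => s i ^ 2) P.Aᵀ P.A 0

/-- The right-hand side `(0, -(1/μ)(b - μ A S⁻¹ e))` of the Newton system. -/
noncomputable def newtonRhs (P : LO m n) (s : Fin n → ℝ) (μ : ℝ) : Fin n ⊕ Fin m → ℝ :=
  Sum.elim 0 (-((1 / μ) • (P.b - μ • (P.A *ᵥ fun i => (s i)⁻¹))))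

/-- The Newton system is nonsingular at every positive `s`. -/
theorem isUnit_det_newtonMatrix (P : LO m n) (hA : P.A.rank = m) {s : Fin n → ℝ}
    (hs : ∀ i, 0 < s i) : IsUnit (P.newtonMatrix s).det := by
  rw [isUnit_iff_ne_zero]
  intro h0
  obtain ⟨z, hz, hMz⟩ := Matrix.exists_mulVec_eq_zero_iff.mpr h0
  obtain ⟨u, v, rfl⟩ : ∃ u v, z = Sum.elim u v := ⟨_, _, (Sum.elim_comp_inl_inr z).symm⟩
  rw [newtonMatrix, Matrix.fromBlocks_mulVec] at hMz
  simp only [Sum.elim_comp_inl, Sum.elim_comp_inr, Matrix.zero_mulVec, add_zero] at hMz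
  have h1 : ∀ i, s i ^ 2 * u i + (P.Aᵀ *ᵥ v) i = 0 := fun i => by
    have := congrFun hMz (Sum.inl i)
    simpa [Matrix.mulVec_diagonal] using this
  have h2 : P.A *ᵥ u = 0 := by
    funext j
    simpa using congrFun hMz (Sum.inr j)
  have h3 : ∑ i, s i ^ 2 * u i ^ 2 = 0 := by
    have h4 : u ⬝ᵥ (P.Aᵀ *ᵥ v) = 0 := by
      rw [Matrix.dotProduct_mulVec, Matrix.vecMul_transpose, h2, zero_dotProduct]
    have h5 : ∑ i, (s i ^ 2 * u i ^ 2 + u i * (P.Aᵀ *ᵥ v) i) = 0 :=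
      Finset.sum_eq_zero fun i _ => by linear_combination u i * h1 i
    rw [Finset.sum_add_distrib] at h5
    rw [dotProduct] at h4
    linarith
  have hu : u = 0 := by
    funext i
    have := (Finset.sum_eq_zero_iff_of_nonneg (fun i _ => by positivity)).mp h3 i (Finset.mem_univ i)
    have hsi := (hs i).ne'
    simpa [hsi] using this
  have hv : P.Aᵀ *ᵥ v = 0 := by
    funext i
    simpa [hu] using h1 i
  have hli : LinearIndependent ℝ P.A.row := by
    rw [linearIndependent_iff_card_eq_finrank_span, Set.finrank, ← Matrix.rank_eq_finrank_span_row, hA,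
      Fintype.card_fin]
  have hv0 : v = 0 := by
    rw [Matrix.mulVec_transpose] at hv
    exact Matrix.vecMul_injective_iff.mpr hli (hv.trans (Matrix.zero_vecMul _).symm)
  apply hz
  funext i
  cases i <;> simp [hu, hv0]

/-- The exact solution `(Δŝ, Δy)` of the Newton system. -/
noncomputable def newtonSol (P : LO m n) (s : Fin n → ℝ) (μ : ℝ) : Fin n ⊕ Fin m → ℝ :=
  (P.newtonMatrix s)⁻¹ *ᵥ P.newtonRhs s μ

/-- The component `Δŝ` of the exact Newton direction. -/
noncomputable def newtonDsHat (P : LO m n) (s : Fin n → ℝ) (μ : ℝ) : Fin n → ℝ :=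
  fun i => P.newtonSol s μ (Sum.inl i)

/-- The component `Δy` of the exact Newton direction. -/
noncomputable def newtonDy (P : LO m n) (s : Fin n → ℝ) (μ : ℝ) : Fin m → ℝ :=
  fun j => P.newtonSol s μ (Sum.inr j)

/-- The exact Newton direction `Δs = S² Δŝ` in the slack variables. -/
noncomputable def newtonDs (P : LO m n) (s : Fin n → ℝ) (μ : ℝ) : Fin n → ℝ :=
  fun i => s i ^ 2 * P.newtonDsHat s μ i

/-- The proximity measure `δ(s, μ) = ‖s⁻¹ Δs‖₂`. -/
noncomputable def proximity (P : LO m n) (s : Fin n → ℝ) (μ : ℝ) : ℝ :=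
  l2norm fun i => (s i)⁻¹ * P.newtonDs s μ i

/-- The primal vector `x = μ S⁻¹(e - S⁻¹ Δs)` that belongs to `(s, μ)`. -/
noncomputable def primalEstimate (P : LO m n) (s : Fin n → ℝ) (μ : ℝ) : Fin n → ℝ :=
  fun i => μ * ((s i)⁻¹ - P.newtonDsHat s μ i)

/-- `(u, v)` solves the Newton system for `(Δŝ, Δy)` at `(s, μ)` with precision `ε`: its Euclidean
distance to the exact solution is at most `ε`, measured either in the unknowns `(Δŝ, Δy)` of the
system or in the unscaled direction `(Δs, Δy)`, where `Δs = S² Δŝ`. -/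
def SolvesNewton (P : LO m n) (s : Fin n → ℝ) (μ ε : ℝ) (u : Fin n → ℝ) (v : Fin m → ℝ) : Prop :=
  l2norm (Sum.elim (u - P.newtonDsHat s μ) (v - P.newtonDy s μ)) ≤ ε ∨
  l2norm (Sum.elim ((fun i => s i ^ 2 * u i) - P.newtonDs s μ) (v - P.newtonDy s μ)) ≤ ε

/-- The first `K` passes through the loop
`while μ > τ: solve the Newton system for (Δŝ, Δy) with precision ε; y += Δy; s += S² Δŝ;
μ := (1 - θ) μ`.
`y k, s k, μ k` are the values before pass `k` (counted from `0`), and `(dsHat k, dy k)` is the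
direction that is computed in it. -/
structure IsExecution (P : LO m n) (τ θ ε : ℝ) (y : ℕ → Fin m → ℝ) (s : ℕ → Fin n → ℝ) (μ : ℕ → ℝ)
    (dsHat : ℕ → Fin n → ℝ) (dy : ℕ → Fin m → ℝ) (K : ℕ) : Prop where
  guard : ∀ k < K, τ < μ k
  solve : ∀ k < K, P.SolvesNewton (s k) (μ k) ε (dsHat k) (dy k)
  y_step : ∀ k < K, y (k + 1) = y k + dy k
  s_step : ∀ k < K, s (k + 1) = s k + fun i => s k i ^ 2 * dsHat k i
  mu_step : ∀ k < K, μ (k + 1) = (1 - θ) * μ k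

/-- The error `ξ` that a direction `(Δŝ, Δy)` computed at `s` leaves in the dual equation:
`ξ = S² Δŝ + Aᵀ Δy`. -/
def dualError (P : LO m n) (s dsHat : Fin n → ℝ) (dy : Fin m → ℝ) : Fin n → ℝ :=
  (fun i => s i ^ 2 * dsHat i) + P.Aᵀ *ᵥ dy

/-- The accumulated perturbation `rᵏ`, the sum of the dual errors of the first `k` passes. -/
def perturbation (P : LO m n) (s dsHat : ℕ → Fin n → ℝ) (dy : ℕ → Fin m → ℝ) (k : ℕ) :
    Fin n → ℝ :=
  ∑ j ∈ Finset.range k, P.dualError (s j) (dsHat j) (dy j)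

/-- Solutions of `A x = b` in which the entries with `x̃ᵢ < τ` are rounded to zero. -/
def roundedPrimal (P : LO m n) (τ : ℝ) (x' : Fin n → ℝ) : Set (Fin n → ℝ) :=
  {x | P.A *ᵥ x = P.b ∧ ∀ i, x' i < τ → x i = 0}

/-- Solutions of `Aᵀy + s = c` in which the entries with `s̃ᵢ < τ` are rounded to zero. -/
def roundedDual (P : LO m n) (τ : ℝ) (s' : Fin n → ℝ) : Set ((Fin m → ℝ) × (Fin n → ℝ)) :=
  {q | P.Aᵀ *ᵥ q.1 + q.2 = P.c ∧ ∀ i, s' i < τ → q.2 i = 0}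

/-- `(x, y, s)` is a result of the rounding procedure with threshold `τ` applied to `(x̃, s̃)`:
the entries below `τ` are set to zero, and `x` and `(y, s)` solve the least squares problems of
minimizing `‖x - x̃‖₂` and `‖s - s̃‖₂` under the remaining primal and dual equations. -/
def IsRounding (P : LO m n) (τ : ℝ) (x' s' : Fin n → ℝ)
    (p : (Fin n → ℝ) × (Fin m → ℝ) × (Fin n → ℝ)) : Prop :=
  (p.1 ∈ P.roundedPrimal τ x' ∧
    IsMinOn (fun x => l2norm (x - x')) (P.roundedPrimal τ x') p.1) ∧
  (p.2 ∈ P.roundedDual τ s' ∧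
    IsMinOn (fun q => l2norm (q.2 - s')) (P.roundedDual τ s') p.2)

end LO

/-- Integer input data of a linear optimization problem. -/
structure IntLO (m n : ℕ) where
  A : Matrix (Fin m) (Fin n) ℤ
  b : Fin m → ℤ
  c : Fin n → ℤ

namespace IntLO

variable {m n : ℕ}

/-- The linear optimization problem with the given integer data. -/
def toLO (I : IntLO m n) : LO m n :=
  ⟨I.A.map fun a => (a : ℝ), fun i => (I.b i : ℝ), fun j => (I.c j : ℝ)⟩

/-- The binary input length
`L = mn + m + n + ∑ ⌈log₂(|aᵢⱼ| + 1)⌉ + ∑ ⌈log₂(|cⱼ| + 1)⌉ + ∑ ⌈log₂(|bᵢ| + 1)⌉`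
(`Nat.clog 2` is the rounded-up binary logarithm). -/
def inputLength (I : IntLO m n) : ℕ :=
  m * n + m + n + ∑ i, ∑ j, Nat.clog 2 ((I.A i j).natAbs + 1)
    + ∑ j, Nat.clog 2 ((I.c j).natAbs + 1) + ∑ i, Nat.clog 2 ((I.b i).natAbs + 1)

end IntLO

/-! Put q = S⁻¹Δs for the exact Newton direction. The primal estimate satisfies xᵢsᵢ = μ(1 - qᵢ), so
a full Newton step turns the products into μ(1 - qᵢ²). Since δ is the least distance of xs/μ from e
over all solutions of Ax = b (`proximity_le`), the step converges quadratically. This leaves room to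
shrink μ by 1 - θ and to tolerate a relative slack error of 1/17 (`newton_step`).

With inexact directions s drifts off the affine dual space. Write s - s⁰ = ρ + Aᵀw, where ρ collects
the slack errors. Orthogonality of ker A and range Aᵀ bounds x and s by multiples of the starting
data as long as ρ is small relative to s⁰ (`iterate_bounds`). These bounds keep the next error
small, which closes an induction (`IsExecution.control`). Write Λ = 2^L, H = 2^(κL), ε = 2^(-tL).
The iteration count is at most of order √n L, hence absorbed by H Λ², and all smallness requirements
follow from ε H³ Λ⁶ ≤ 1, which is t ≥ 3κ + 6.

For the rounding, limits of nearly central points give a strictly complementary optimal pair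
(`exists_strictly_complementary`), so B and N partition the indices. Orthogonality against an
optimal pair shows ∑(xᵢsᵢ* + xᵢ*sᵢ) ≤ 7/4 nμ (`optimality_gap_le`). Optimal vertices have positive
entries at least 1/d for a nonzero subdeterminant d (`exists_primal_basis`, `exists_dual_basis`). So
once μ ≤ Λ⁻² the entries of x and s separate at 1/Λ. By Cramer's rule the small entries can be
replaced by zero while the large ones change by less than their size (`exists_primal_repair`,
`exists_dual_repair`). The least squares solution is no farther away, so its remaining entries are
positive, and it is feasible and complementary (`IntLO.rounding_optimal`). -/

section EuclideanNorm

/-! ### Elementary facts on the Euclidean norm -/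

variable {ι ι' : Type*} [Fintype ι] [Fintype ι']

theorem l2norm_sq (v : ι → ℝ) : l2norm v ^ 2 = ∑ i, v i ^ 2 := by
  simp [l2norm, EuclideanSpace.norm_sq_eq]

theorem l2norm_nonneg (v : ι → ℝ) : 0 ≤ l2norm v := norm_nonneg _

theorem l2norm_add_le (v w : ι → ℝ) : l2norm (v + w) ≤ l2norm v + l2norm w := by
  simpa [l2norm] using norm_add_le (WithLp.toLp 2 v) (WithLp.toLp 2 w)

theorem l2norm_zero : l2norm (0 : ι → ℝ) = 0 := by
  simp [l2norm]

theorem l2norm_smul (a : ℝ) (v : ι → ℝ) : l2norm (a • v) = |a| * l2norm v := by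
  simp [l2norm, norm_smul]

theorem abs_apply_le_l2norm (v : ι → ℝ) (i : ι) : |v i| ≤ l2norm v := by
  simpa [l2norm] using PiLp.norm_apply_le (WithLp.toLp 2 v) i

theorem l2norm_le_of_sq_le {v : ι → ℝ} {a : ℝ} (ha : 0 ≤ a) (h : ∑ i, v i ^ 2 ≤ a ^ 2) :
    l2norm v ≤ a := by
  rw [← l2norm_sq] at h
  exact (pow_le_pow_iff_left₀ (l2norm_nonneg v) ha two_ne_zero).mp h

theorem l2norm_mono {v w : ι → ℝ} (h : ∀ i, |v i| ≤ |w i|) : l2norm v ≤ l2norm w := by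
  refine l2norm_le_of_sq_le (l2norm_nonneg w) ?_
  rw [l2norm_sq]
  exact Finset.sum_le_sum fun i _ => sq_le_sq.mpr (h i)

theorem l2norm_le_of_abs_le_mul {v w : ι → ℝ} {a : ℝ} (ha : 0 ≤ a) (h : ∀ i, |v i| ≤ a * |w i|) :
    l2norm v ≤ a * l2norm w := by
  have := l2norm_mono (v := v) (w := a • w) fun i => by
    simpa [abs_mul, abs_of_nonneg ha] using h i
  rwa [l2norm_smul, abs_of_nonneg ha] at this

theorem l2norm_le_sum_abs (v : ι → ℝ) : l2norm v ≤ ∑ i, |v i| := by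
  refine l2norm_le_of_sq_le (Finset.sum_nonneg fun i _ => abs_nonneg _) ?_
  have := Finset.sum_sq_le_sq_sum_of_nonneg (s := Finset.univ) (f := fun i => |v i|)
    fun i _ => abs_nonneg _
  simpa using this

theorem l2norm_inl_le (v : ι → ℝ) (w : ι' → ℝ) : l2norm v ≤ l2norm (Sum.elim v w) := by
  refine l2norm_le_of_sq_le (l2norm_nonneg _) ?_
  rw [l2norm_sq, Fintype.sum_sum_type]
  simpa using Finset.sum_nonneg fun i _ => sq_nonneg (w i)

theorem l2norm_inr_le (v : ι → ℝ) (w : ι' → ℝ) : l2norm w ≤ l2norm (Sum.elim v w) := by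
  refine l2norm_le_of_sq_le (l2norm_nonneg _) ?_
  rw [l2norm_sq, Fintype.sum_sum_type]
  simpa using Finset.sum_nonneg fun i _ => sq_nonneg (v i)

theorem l2norm_sum_le {α : Type*} (t : Finset α) (f : α → ι → ℝ) :
    l2norm (∑ j ∈ t, f j) ≤ ∑ j ∈ t, l2norm (f j) := by
  classical
  induction t using Finset.induction_on with
  | empty => simp [l2norm_zero]
  | insert a t ha ih =>
    rw [Finset.sum_insert ha, Finset.sum_insert ha]
    exact (l2norm_add_le _ _).trans (by gcongr)

theorem l2norm_mulVec_le (A : Matrix ι ι' ℝ) (v : ι' → ℝ) :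
    l2norm (A *ᵥ v) ≤ (∑ i, ∑ j, |A i j|) * l2norm v := by
  refine (l2norm_le_sum_abs _).trans ?_
  rw [Finset.sum_mul]
  refine Finset.sum_le_sum fun i _ => ?_
  rw [Finset.sum_mul]
  refine (Finset.abs_sum_le_sum_abs _ _).trans (Finset.sum_le_sum fun j _ => ?_)
  rw [abs_mul]
  gcongr
  exact abs_apply_le_l2norm v j

end EuclideanNorm

/-! ### The Newton direction, the proximity measure and a single inexact step -/

theorem dotProduct_transpose_mulVec_eq_zero {m n : ℕ} {A : Matrix (Fin m) (Fin n) ℝ}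
    {z : Fin n → ℝ} (hz : A *ᵥ z = 0) (w : Fin m → ℝ) : z ⬝ᵥ (Aᵀ *ᵥ w) = 0 := by
  rw [Matrix.dotProduct_mulVec, Matrix.vecMul_transpose, hz, zero_dotProduct]

namespace LO

variable {m n : ℕ} {P : LO m n} {s : Fin n → ℝ} {μ : ℝ}

theorem newtonMatrix_mulVec_newtonSol (hA : P.A.rank = m) (hs : ∀ i, 0 < s i) :
    P.newtonMatrix s *ᵥ P.newtonSol s μ = P.newtonRhs s μ := by
  rw [newtonSol, Matrix.mulVec_mulVec, Matrix.mul_nonsing_inv _ (P.isUnit_det_newtonMatrix hA hs),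
    Matrix.one_mulVec]

theorem newtonSol_eq : P.newtonSol s μ = Sum.elim (P.newtonDsHat s μ) (P.newtonDy s μ) := by
  funext i
  cases i <;> rfl

theorem newtonDs_eq (hA : P.A.rank = m) (hs : ∀ i, 0 < s i) :
    P.newtonDs s μ = P.Aᵀ *ᵥ (-P.newtonDy s μ) := by
  have h := newtonMatrix_mulVec_newtonSol (μ := μ) hA hs
  rw [newtonSol_eq, newtonMatrix, Matrix.fromBlocks_mulVec] at h
  funext i
  have := congrFun h (Sum.inl i)
  simp only [newtonRhs, Sum.elim_inl, Sum.elim_comp_inl, Sum.elim_comp_inr, Pi.add_apply,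
    Matrix.mulVec_diagonal, Pi.zero_apply] at this
  rw [Matrix.mulVec_neg, Pi.neg_apply, newtonDs]
  linarith

theorem mulVec_newtonDsHat (hA : P.A.rank = m) (hs : ∀ i, 0 < s i) :
    P.A *ᵥ P.newtonDsHat s μ = -((1 / μ) • (P.b - μ • (P.A *ᵥ fun i => (s i)⁻¹))) := by
  have h := newtonMatrix_mulVec_newtonSol (μ := μ) hA hs
  rw [newtonSol_eq, newtonMatrix, Matrix.fromBlocks_mulVec] at h
  funext i
  have := congrFun h (Sum.inr i)
  simpa [newtonRhs] using this

theorem mulVec_primalEstimate (hA : P.A.rank = m) (hs : ∀ i, 0 < s i) (hμ : 0 < μ) :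
    P.A *ᵥ P.primalEstimate s μ = P.b := by
  have : P.primalEstimate s μ = μ • ((fun i => (s i)⁻¹) - P.newtonDsHat s μ) := by
    funext i; simp [primalEstimate]
  rw [this, Matrix.mulVec_smul, Matrix.mulVec_sub, mulVec_newtonDsHat hA hs]
  funext i
  simp only [Pi.smul_apply, Pi.sub_apply, Pi.neg_apply, smul_eq_mul]
  field_simp
  ring

theorem inv_mul_newtonDs (hs : ∀ i, 0 < s i) (i : Fin n) :
    (s i)⁻¹ * P.newtonDs s μ i = s i * P.newtonDsHat s μ i := by
  have := (hs i).ne'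
  rw [newtonDs]
  field_simp

theorem primalEstimate_mul (hs : ∀ i, 0 < s i) (i : Fin n) :
    P.primalEstimate s μ i * s i = μ * (1 - (s i)⁻¹ * P.newtonDs s μ i) := by
  have := (hs i).ne'
  rw [primalEstimate, inv_mul_newtonDs hs]
  field_simp

theorem abs_inv_mul_newtonDs_le (i : Fin n) :
    |(s i)⁻¹ * P.newtonDs s μ i| ≤ P.proximity s μ :=
  abs_apply_le_l2norm (fun i => (s i)⁻¹ * P.newtonDs s μ i) i

/-- Pythagoras: xs/μ - e is (x - x₀)s/μ minus q, where x₀ is the primal estimate. The two parts are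
orthogonal because x - x₀ lies in ker A and Δs in range Aᵀ. No sign condition on x is involved. -/
theorem proximity_le (hA : P.A.rank = m) (hs : ∀ i, 0 < s i) (hμ : 0 < μ) {x : Fin n → ℝ}
    (hx : P.A *ᵥ x = P.b) : P.proximity s μ ≤ l2norm fun i => x i * s i / μ - 1 := by
  set x₀ := P.primalEstimate s μ with hx₀
  set q : Fin n → ℝ := fun i => (s i)⁻¹ * P.newtonDs s μ i with hq
  have horth : ∑ i, q i * ((x i - x₀ i) * s i) = 0 := by
    have h0 : P.A *ᵥ (x - x₀) = 0 := by
      rw [Matrix.mulVec_sub, hx, mulVec_primalEstimate hA hs hμ, sub_self]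
    have := dotProduct_transpose_mulVec_eq_zero h0 (-P.newtonDy s μ)
    rw [← newtonDs_eq hA hs, dotProduct] at this
    rw [← this]
    refine Finset.sum_congr rfl fun i _ => ?_
    have := (hs i).ne'
    simp only [hq, Pi.sub_apply]
    field_simp
  have hdec : ∀ i, x i * s i / μ - 1 = (x i - x₀ i) * s i / μ - q i := fun i => by
    have h1 : x₀ i * s i = μ * (1 - q i) := primalEstimate_mul hs i
    rw [sub_mul, h1, sub_div, mul_div_cancel_left₀ _ hμ.ne']
    ring
  refine l2norm_le_of_sq_le (l2norm_nonneg _) ?_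
  rw [l2norm_sq]
  have : ∑ i, (x i * s i / μ - 1) ^ 2 =
      ∑ i, ((x i - x₀ i) * s i / μ) ^ 2 + ∑ i, q i ^ 2
        - 2 / μ * ∑ i, q i * ((x i - x₀ i) * s i) := by
    rw [Finset.mul_sum, ← Finset.sum_add_distrib, ← Finset.sum_sub_distrib]
    refine Finset.sum_congr rfl fun i _ => ?_
    rw [hdec]
    ring
  rw [this, horth, mul_zero, sub_zero]
  exact le_add_of_nonneg_left (Finset.sum_nonneg fun i _ => sq_nonneg _)

theorem primalEstimate_mul_bounds (hs : ∀ i, 0 < s i) (hμ : 0 < μ) (hδ : P.proximity s μ < 1 / 2)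
    (i : Fin n) : μ / 2 < P.primalEstimate s μ i * s i ∧
      P.primalEstimate s μ i * s i < 3 / 2 * μ := by
  have h := abs_lt.mp ((abs_inv_mul_newtonDs_le (P := P) (s := s) (μ := μ) i).trans_lt hδ)
  rw [primalEstimate_mul hs]
  constructor <;> nlinarith

theorem primalEstimate_pos (hs : ∀ i, 0 < s i) (hμ : 0 < μ) (hδ : P.proximity s μ < 1 / 2)
    (i : Fin n) : 0 < P.primalEstimate s μ i :=
  pos_of_mul_pos_left (lt_trans (by positivity) (primalEstimate_mul_bounds hs hμ hδ i).1)
    (hs i).le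

/-- The exact-step part of the new proximity: each entry is (θ - qᵢ²)/(1 - θ). With u = ∑ qᵢ² ≤ 1/4,
the squared norm has numerator at most 1/16 - 2θu + u/4; the cross term compensates for the
denominator (1 - θ)² when θ is near 1/4. -/
theorem proximity_sq_bound {ι : Type*} [Fintype ι] {θ : ℝ} {q : ι → ℝ} (hθ : 0 ≤ θ)
    (hθ4 : θ ≤ 1 / 4) (hθn : θ ^ 2 * Fintype.card ι ≤ 1 / 16) (hq : l2norm q < 1 / 2) :
    l2norm (fun i => (1 - q i ^ 2) / (1 - θ) - 1) ≤ 3 / 8 := by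
  have hq2 : ∑ i, q i ^ 2 ≤ 1 / 4 := by
    rw [← l2norm_sq]
    nlinarith [l2norm_nonneg q]
  have hq0 : 0 ≤ ∑ i, q i ^ 2 := Finset.sum_nonneg fun i _ => sq_nonneg _
  have hq4 : ∑ i, (q i ^ 2) ^ 2 ≤ (∑ i, q i ^ 2) ^ 2 :=
    Finset.sum_sq_le_sq_sum_of_nonneg fun i _ => sq_nonneg _
  refine l2norm_le_of_sq_le (by norm_num) ?_
  have hsum : ∑ i, ((1 - q i ^ 2) / (1 - θ) - 1) ^ 2 =
      (θ ^ 2 * Fintype.card ι - 2 * θ * ∑ i, q i ^ 2 + ∑ i, (q i ^ 2) ^ 2) / (1 - θ) ^ 2 := by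
    rw [Finset.mul_sum, mul_comm (θ ^ 2), ← nsmul_eq_mul, ← Finset.card_univ, ← Finset.sum_const,
      ← Finset.sum_sub_distrib, ← Finset.sum_add_distrib, Finset.sum_div]
    refine Finset.sum_congr rfl fun i _ => ?_
    have : 1 - θ ≠ 0 := by linarith
    field_simp
    ring
  rw [hsum, div_le_iff₀ (by nlinarith)]
  set u := ∑ i, q i ^ 2
  have : u ^ 2 ≤ u / 4 := by nlinarith
  nlinarith [mul_nonneg hθ (sub_nonneg.mpr hq2), sq_nonneg θ, mul_nonneg hθ hq0]

/-- A slightly inexact Newton step followed by a reduction of `μ` keeps the iterate close to the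
central path. -/
theorem newton_step (hA : P.A.rank = m) (hs : ∀ i, 0 < s i) (hμ : 0 < μ)
    (hδ : P.proximity s μ < 1 / 2) {θ : ℝ} (hθ : 0 ≤ θ) (hθ4 : θ ≤ 1 / 4)
    (hθn : θ ^ 2 * n ≤ 1 / 16) {e : Fin n → ℝ} (he : l2norm (fun i => (s i)⁻¹ * e i) ≤ 1 / 17) :
    (∀ i, 0 < s i + P.newtonDs s μ i + e i) ∧
      P.proximity (fun i => s i + P.newtonDs s μ i + e i) ((1 - θ) * μ) < 1 / 2 := by
  set q : Fin n → ℝ := fun i => (s i)⁻¹ * P.newtonDs s μ i with hq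
  set f : Fin n → ℝ := fun i => (s i)⁻¹ * e i with hf
  have hqa : ∀ i, |q i| < 1 / 2 := fun i => (abs_inv_mul_newtonDs_le i).trans_lt hδ
  have hfa : ∀ i, |f i| ≤ 1 / 17 := fun i => (abs_apply_le_l2norm f i).trans he
  have hnew : ∀ i, s i + P.newtonDs s μ i + e i = s i * (1 + q i + f i) := fun i => by
    have := (hs i).ne'
    simp only [hq, hf]
    field_simp
  have hpos : ∀ i, 0 < s i + P.newtonDs s μ i + e i := fun i => by
    rw [hnew]
    exact mul_pos (hs i) (by linarith [(abs_lt.mp (hqa i)).1, (abs_le.mp (hfa i)).1])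
  refine ⟨hpos, ?_⟩
  have h1θ : 0 < 1 - θ := by linarith
  -- The primal estimate of the old point solves Ax = b and serves as the comparison vector for the
  -- new point.
  refine (proximity_le hA hpos (mul_pos h1θ hμ) (mulVec_primalEstimate hA hs hμ)).trans_lt ?_
  have hsplit :
      (fun i => P.primalEstimate s μ i * (s i + P.newtonDs s μ i + e i) / ((1 - θ) * μ) - 1)
      = (fun i => (1 - q i ^ 2) / (1 - θ) - 1) + fun i => (1 - q i) * f i / (1 - θ) := by
    funext i
    have h1 : P.primalEstimate s μ i * s i = μ * (1 - q i) := primalEstimate_mul hs i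
    have h2 : P.primalEstimate s μ i * (s i + P.newtonDs s μ i + e i)
        = μ * (1 - q i) * (1 + q i + f i) := by
      rw [hnew, ← mul_assoc, h1]
    rw [h2, Pi.add_apply]
    have := h1θ.ne'
    field_simp
    ring
  rw [hsplit]
  have h1 : l2norm (fun i => (1 - q i ^ 2) / (1 - θ) - 1) ≤ 3 / 8 :=
    proximity_sq_bound hθ hθ4 (by simpa using hθn) hδ
  have h2 : l2norm (fun i => (1 - q i) * f i / (1 - θ)) ≤ 2 * l2norm f := by
    refine l2norm_le_of_abs_le_mul zero_le_two fun i => ?_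
    rw [abs_div, abs_mul, abs_of_pos h1θ, div_le_iff₀ h1θ]
    have h3 : |1 - q i| ≤ 3 / 2 := abs_le.mpr
      ⟨by linarith [(abs_lt.mp (hqa i)).2], by linarith [(abs_lt.mp (hqa i)).1]⟩
    nlinarith [abs_nonneg (f i)]
  -- This fixes the tolerance 1/17: 3/8 + 2/17 = 67/136 < 1/2.
  linarith [l2norm_add_le (fun i => (1 - q i ^ 2) / (1 - θ) - 1)
    fun i => (1 - q i) * f i / (1 - θ)]

end LO

/-! ### Bounds on the iterates and accumulation of errors along a run -/

namespace LO

variable {m n : ℕ} {P : LO m n}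

/-- Iterates whose slack vector differs from a dual feasible one by a small relative perturbation
are bounded in terms of the starting point. -/
theorem iterate_bounds (hA : P.A.rank = m) (hn : 0 < n) {s₀ s ρ : Fin n → ℝ} {w : Fin m → ℝ}
    {μ₀ μ β : ℝ} (hs₀ : ∀ i, 0 < s₀ i) (hs : ∀ i, 0 < s i) (hμ : 0 < μ) (hμ₀ : μ ≤ μ₀)
    (hδ₀ : P.proximity s₀ μ₀ < 1 / 2) (hδ : P.proximity s μ < 1 / 2)
    (hdual : s = s₀ + ρ + P.Aᵀ *ᵥ w) (hρ : ∀ i, |ρ i| ≤ s₀ i / 10)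
    (hβ : (m = 0 ∧ 6 / 5 ≤ β) ∨ 7 * (n : ℝ) ≤ β) (i : Fin n) :
    s i ≤ β * s₀ i ∧ P.primalEstimate s μ i * s₀ i ≤ β * μ₀ := by
  have hμ₀' : 0 < μ₀ := hμ.trans_le hμ₀
  -- For m = 0 the range of Aᵀ is trivial and s differs from s₀ only by ρ, so β = 6/5 works. The
  -- case is kept apart because the input length then guarantees only 2n ≤ L, which has no room for
  -- β = 7n.
  rcases hβ with ⟨hm, hβ⟩ | hβ
  · subst hm
    have hw : P.Aᵀ *ᵥ w = 0 := by
      funext i; simp [Matrix.mulVec, dotProduct]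
    have hdS : P.newtonDs s μ i = 0 := by
      rw [newtonDs_eq hA hs]; simp [Matrix.mulVec, dotProduct]
    have h1 : P.primalEstimate s μ i * s i = μ := by
      rw [primalEstimate_mul hs, hdS]; ring
    have h2 : s i = s₀ i + ρ i := by rw [hdual, hw]; simp
    have h3 := abs_le.mp (hρ i)
    have h4 := primalEstimate_pos hs hμ hδ i
    have h5 := hs₀ i
    constructor
    · nlinarith
    · have : P.primalEstimate s μ i * s₀ i * (9 / 10) ≤ μ := by
        calc _ = P.primalEstimate s μ i * (s₀ i * (9 / 10)) := by ring
          _ ≤ P.primalEstimate s μ i * s i := mul_le_mul_of_nonneg_left (by linarith) h4.le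
          _ = μ := h1
      nlinarith
  · set x := P.primalEstimate s μ
    set x₀ := P.primalEstimate s₀ μ₀
    have hx : ∀ j, 0 < x j := primalEstimate_pos hs hμ hδ
    have hx₀ : ∀ j, 0 < x₀ j := primalEstimate_pos hs₀ hμ₀' hδ₀
    have hxs : ∀ j, μ / 2 < x j * s j ∧ x j * s j < 3 / 2 * μ := primalEstimate_mul_bounds hs hμ hδ
    have hxs₀ : ∀ j, μ₀ / 2 < x₀ j * s₀ j ∧ x₀ j * s₀ j < 3 / 2 * μ₀ :=
      primalEstimate_mul_bounds hs₀ hμ₀' hδ₀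
    have horth : ∑ j, (x j - x₀ j) * (s j - s₀ j - ρ j) = 0 := by
      have h0 : P.A *ᵥ (x - x₀) = 0 := by
        rw [Matrix.mulVec_sub, mulVec_primalEstimate hA hs hμ, mulVec_primalEstimate hA hs₀ hμ₀',
          sub_self]
      rw [← dotProduct_transpose_mulVec_eq_zero h0 w, dotProduct]
      refine Finset.sum_congr rfl fun j _ => ?_
      rw [hdual]
      simp only [Pi.add_apply, Pi.sub_apply]
      ring
    -- Expanding the orthogonality relation: xs and x₀s₀ are each below 3/2 μ₀, and ρ costs at most
    -- (x s₀ + x₀s₀)/10. The first part of this cost leaves the factor 9/10, the second adds 3/20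
    -- μ₀.
    have hsum : ∑ j, (9 / 10 * (x j * s₀ j) + x₀ j * s j) ≤ ∑ _j : Fin n, 63 / 20 * μ₀ := by
      have : ∑ j, (9 / 10 * (x j * s₀ j) + x₀ j * s j) - ∑ _j : Fin n, 63 / 20 * μ₀
          = ∑ j, (9 / 10 * (x j * s₀ j) + x₀ j * s j - 63 / 20 * μ₀
            + (x j - x₀ j) * (s j - s₀ j - ρ j)) := by
        rw [Finset.sum_add_distrib (g := fun j => (x j - x₀ j) * (s j - s₀ j - ρ j)), horth,
          add_zero, Finset.sum_sub_distrib]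
      rw [← sub_nonpos, this]
      refine Finset.sum_nonpos fun j _ => ?_
      have h1 := hxs j
      have h2 := hxs₀ j
      have h3 := abs_le.mp (hρ j)
      have h4 := mul_le_mul_of_nonneg_left h3.1 (hx j).le
      have h5 := mul_le_mul_of_nonneg_left h3.2 (hx₀ j).le
      nlinarith
    rw [Finset.sum_const, Finset.card_univ, Fintype.card_fin, nsmul_eq_mul] at hsum
    have hone : 9 / 10 * (x i * s₀ i) + x₀ i * s i ≤ n * (63 / 20 * μ₀) :=
      (Finset.single_le_sum (f := fun j => 9 / 10 * (x j * s₀ j) + x₀ j * s j)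
        (fun j _ => by have := hx j; have := hs₀ j; have := hx₀ j; have := hs j; positivity)
        (Finset.mem_univ i)).trans hsum
    have ha := mul_pos (hx i) (hs₀ i)
    have hb := mul_pos (hx₀ i) (hs i)
    have hnμ : 7 * (n : ℝ) * μ₀ ≤ β * μ₀ := by gcongr
    have hn' : (0 : ℝ) < n * μ₀ := by positivity
    refine ⟨?_, by nlinarith⟩
    have h1 : x₀ i * s i ≤ n * (63 / 20 * μ₀) := by linarith
    have h2 : μ₀ / 2 * s i ≤ n * (63 / 20 * μ₀) * s₀ i := by
      calc μ₀ / 2 * s i ≤ x₀ i * s₀ i * s i := by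
            gcongr
            · exact (hs i).le
            · exact (hxs₀ i).1.le
        _ = x₀ i * s i * s₀ i := by ring
        _ ≤ _ := by
            gcongr
            exact (hs₀ i).le
    have h3 : μ₀ * s i ≤ μ₀ * (7 * n * s₀ i) := by
      nlinarith [mul_pos hn' (hs₀ i)]
    have h4 := le_of_mul_le_mul_left h3 hμ₀'
    nlinarith [mul_le_mul_of_nonneg_right hβ (hs₀ i).le]

/-- The error in the slack variables of an inexact Newton step. -/
theorem SolvesNewton.slack_error {s : Fin n → ℝ} {μ ε l h : ℝ} {u : Fin n → ℝ} {v : Fin m → ℝ}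
    (hsol : P.SolvesNewton s μ ε u v) (hε : 0 ≤ ε) (hs : ∀ i, 0 < s i) (hl : 17 * ε ≤ l)
    (hls : ∀ i, l ≤ s i) (hsh : ∀ i, s i ≤ h) (hh : 17 * h * ε ≤ 1) (h1 : 1 ≤ h) :
    l2norm (fun i => (s i)⁻¹ * (s i ^ 2 * u i - P.newtonDs s μ i)) ≤ 1 / 17 ∧
    (∀ i, |s i ^ 2 * u i - P.newtonDs s μ i| ≤ (s i ^ 2 + 1) * ε) ∧
    l2norm (fun i => s i ^ 2 * u i - P.newtonDs s μ i) ≤ h ^ 2 * ε ∧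
    l2norm (v - P.newtonDy s μ) ≤ ε := by
  -- Relative to the slack, an error in Δŝ is multiplied by sᵢ and an error in Δs by 1/sᵢ. The first
  -- case therefore uses the upper bound h, the second the lower bound l.
  rcases hsol with hsol | hsol
  · have hu := (l2norm_inl_le _ _).trans hsol
    have hv := (l2norm_inr_le _ _).trans hsol
    have heq : ∀ i, s i ^ 2 * u i - P.newtonDs s μ i = s i ^ 2 * (u - P.newtonDsHat s μ) i :=
      fun i => by rw [newtonDs, Pi.sub_apply]; ring
    refine ⟨?_, ?_, ?_, hv⟩
    · have : l2norm (fun i => (s i)⁻¹ * (s i ^ 2 * u i - P.newtonDs s μ i)) ≤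
          h * l2norm (u - P.newtonDsHat s μ) := by
        refine l2norm_le_of_abs_le_mul (by linarith) fun i => ?_
        have := (hs i).ne'
        rw [heq, show (s i)⁻¹ * (s i ^ 2 * (u - P.newtonDsHat s μ) i) =
          s i * (u - P.newtonDsHat s μ) i by field_simp, abs_mul, abs_of_pos (hs i)]
        gcongr
        exact hsh i
      nlinarith
    · intro i
      rw [heq, abs_mul, abs_of_nonneg (sq_nonneg _)]
      have := (abs_apply_le_l2norm _ i).trans hu
      nlinarith [sq_nonneg (s i)]
    · have : l2norm (fun i => s i ^ 2 * u i - P.newtonDs s μ i) ≤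
          h ^ 2 * l2norm (u - P.newtonDsHat s μ) := by
        refine l2norm_le_of_abs_le_mul (by positivity) fun i => ?_
        rw [heq, abs_mul, abs_of_nonneg (sq_nonneg _)]
        gcongr
        · exact (hs i).le
        · exact hsh i
      exact this.trans (by gcongr)
  · have hu : l2norm (fun i => s i ^ 2 * u i - P.newtonDs s μ i) ≤ ε :=
      (l2norm_inl_le ((fun i => s i ^ 2 * u i) - P.newtonDs s μ) _).trans hsol
    have hv := (l2norm_inr_le _ _).trans hsol
    refine ⟨?_, ?_, ?_, hv⟩
    -- When ε = 0, the condition 17ε ≤ l does not make l positive.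
    · rcases eq_or_lt_of_le hε with h0 | h0
      · have hz : ∀ i, s i ^ 2 * u i - P.newtonDs s μ i = 0 := fun i => by
          have := (abs_apply_le_l2norm (fun i => s i ^ 2 * u i - P.newtonDs s μ i) i).trans hu
          rw [← h0] at this
          exact abs_nonpos_iff.mp this
        simp only [hz, mul_zero]
        exact l2norm_zero.le.trans (by norm_num)
      · have hl0 : 0 < l := by linarith
        have : l2norm (fun i => (s i)⁻¹ * (s i ^ 2 * u i - P.newtonDs s μ i)) ≤
            l⁻¹ * l2norm (fun i => s i ^ 2 * u i - P.newtonDs s μ i) := by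
          refine l2norm_le_of_abs_le_mul (by positivity) fun i => ?_
          rw [abs_mul, abs_of_pos (inv_pos.mpr (hs i))]
          gcongr
          exact hls i
        refine this.trans ((mul_le_mul_of_nonneg_left hu (by positivity)).trans ?_)
        rw [inv_mul_le_iff₀ hl0]
        linarith
    · intro i
      have := (abs_apply_le_l2norm (fun i => s i ^ 2 * u i - P.newtonDs s μ i) i).trans hu
      nlinarith [sq_nonneg (s i)]
    · exact hu.trans (le_mul_of_one_le_left hε (one_le_pow₀ h1))

theorem IsExecution.mu_eq {τ θ ε : ℝ} {y : ℕ → Fin m → ℝ} {s : ℕ → Fin n → ℝ} {μ : ℕ → ℝ}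
    {dsHat : ℕ → Fin n → ℝ} {dy : ℕ → Fin m → ℝ} {K : ℕ}
    (h : P.IsExecution τ θ ε y s μ dsHat dy K) {k : ℕ} (hk : k ≤ K) :
    μ k = (1 - θ) ^ k * μ 0 := by
  induction k with
  | zero => simp
  | succ k ih => rw [h.mu_step k hk, ih (by omega), pow_succ]; ring

theorem IsExecution.dual_feasible {τ θ ε : ℝ} {y : ℕ → Fin m → ℝ} {s : ℕ → Fin n → ℝ} {μ : ℕ → ℝ}
    {dsHat : ℕ → Fin n → ℝ} {dy : ℕ → Fin m → ℝ} {K : ℕ}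
    (h : P.IsExecution τ θ ε y s μ dsHat dy K) (h0 : P.Aᵀ *ᵥ y 0 + s 0 = P.c) {k : ℕ}
    (hk : k ≤ K) : P.Aᵀ *ᵥ y k + s k = P.c + P.perturbation s dsHat dy k := by
  induction k with
  | zero => simpa [perturbation] using h0
  | succ k ih =>
    have := ih (by omega)
    rw [perturbation, Finset.sum_range_succ, ← perturbation, h.y_step k hk, h.s_step k hk,
      dualError, Matrix.mulVec_add, ← add_assoc P.c, ← this]
    abel

/-- The quantities that an execution keeps under control. -/
structure IterateControl (P : LO m n) (s₀ : Fin n → ℝ) (β ε : ℝ) (s : Fin n → ℝ) (μ : ℝ)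
    (k : ℕ) : Prop where
  pos : ∀ i, 0 < s i
  prox : P.proximity s μ < 1 / 2
  near : ∃ (ρ : Fin n → ℝ) (w : Fin m → ℝ), s = s₀ + ρ + P.Aᵀ *ᵥ w ∧
    ∀ i, |ρ i| ≤ k * ((β ^ 2 * s₀ i ^ 2 + 1) * ε)

section Run

variable {θ ε H Λ β : ℝ} {y : ℕ → Fin m → ℝ} {s : ℕ → Fin n → ℝ} {μ : ℕ → ℝ}
  {dsHat : ℕ → Fin n → ℝ} {dy : ℕ → Fin m → ℝ} {K : ℕ}

/-- Here a stands for a starting slack. Since 1/H ≤ a ≤ H, both a² and 1 are at most aH, so the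
error after k passes becomes proportional to a itself. -/
theorem accumulated_error_le (hε : 0 < ε) (hΛ : 4 ≤ Λ) (hH : Λ ≤ H)
    (hεH : ε * (H ^ 3 * Λ ^ 6) ≤ 1) (hK : K * (β ^ 2 + 1) ≤ H * Λ ^ 2) {k : ℕ} (hk : k ≤ K)
    {a : ℝ} (ha : 1 / H ≤ a) (haH : a ≤ H) :
    k * ((β ^ 2 * a ^ 2 + 1) * ε) ≤ a / (H * Λ ^ 4) := by
  have hΛ0 : 0 < Λ := by linarith
  have hH0 : 0 < H := by linarith
  have ha0 : 0 < a := lt_of_lt_of_le (by positivity) ha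
  have haH1 : 1 ≤ a * H := by rwa [div_le_iff₀ hH0] at ha
  have hkK : (k : ℝ) ≤ K := by exact_mod_cast hk
  have h1 : β ^ 2 * a ^ 2 + 1 ≤ a * H * (β ^ 2 + 1) := by
    have : β ^ 2 * a ^ 2 ≤ β ^ 2 * (a * H) := by
      rw [sq a]; gcongr
    nlinarith
  calc k * ((β ^ 2 * a ^ 2 + 1) * ε) ≤ K * ((a * H * (β ^ 2 + 1)) * ε) := by gcongr
    _ = K * (β ^ 2 + 1) * (a * H * ε) := by ring
    _ ≤ H * Λ ^ 2 * (a * H * ε) := by gcongr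
    _ = ε * (H ^ 3 * Λ ^ 6) * (a / (H * Λ ^ 4)) := by field_simp
    _ ≤ 1 * (a / (H * Λ ^ 4)) := by gcongr
    _ = _ := one_mul _

/-- Everything is proved in one induction: proximity and a small ρ bound the slacks, the bounds make
the next relative error at most 1/17, `newton_step` restores proximity, and ρ grows by one more
small error. -/
theorem IsExecution.control (hA : P.A.rank = m) (hn : 0 < n)
    (hβ : (m = 0 ∧ 6 / 5 ≤ β) ∨ 7 * (n : ℝ) ≤ β) (hε : 0 < ε) (hΛ : 4 ≤ Λ) (hH : Λ ≤ H)
    (hεH : ε * (H ^ 3 * Λ ^ 6) ≤ 1) (hK : K * (β ^ 2 + 1) ≤ H * Λ ^ 2) (hβΛ : 13 * n * β ≤ Λ ^ 2)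
    (hs₀ : ∀ i, 1 / H ≤ s 0 i ∧ s 0 i ≤ H) (hμ₀ : 0 < μ 0) (hμH : μ 0 ≤ H)
    (hδ : P.proximity (s 0) (μ 0) < 1 / 2) (hθ : 0 ≤ θ) (hθ4 : θ ≤ 1 / 4)
    (hθn : θ ^ 2 * n ≤ 1 / 16) (h : P.IsExecution (1 / Λ ^ 2) θ ε y s μ dsHat dy K) :
    ∀ k ≤ K, P.IterateControl (s 0) β ε (s k) (μ k) k ∧
      l2norm (∑ j ∈ Finset.range k, fun i => s j i ^ 2 * dsHat j i - P.newtonDs (s j) (μ j) i)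
        ≤ k * (β ^ 2 * H ^ 2 * ε) ∧
      ∀ j < k, l2norm (dy j - P.newtonDy (s j) (μ j)) ≤ ε := by
  have hΛ0 : 0 < Λ := by linarith
  have hH0 : 0 < H := by linarith
  have hn1 : (1 : ℝ) ≤ n := by exact_mod_cast hn
  have hβ1 : 1 ≤ β := by rcases hβ with hβ | hβ <;> linarith
  have hs₀p : ∀ i, 0 < s 0 i := fun i => lt_of_lt_of_le (by positivity) (hs₀ i).1
  have hΛ4 : 256 ≤ Λ ^ 4 := by
    calc (256 : ℝ) = 4 ^ 4 := by norm_num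
      _ ≤ Λ ^ 4 := by gcongr
  intro k
  induction k with
  | zero =>
    intro _
    refine ⟨⟨hs₀p, hδ, 0, 0, by simp, fun i => by simp⟩, ?_, fun j hj => absurd hj (by omega)⟩
    simp [l2norm_zero]
  | succ k ih =>
    intro hk
    obtain ⟨⟨hpos, hprox, ρ, w, hdual, hρ⟩, hη, hdy⟩ := ih (by omega)
    have hμk : 0 < μ k := lt_trans (by positivity) (h.guard k hk)
    have hμk0 : μ k ≤ μ 0 := by
      rw [h.mu_eq (by omega)]
      exact mul_le_of_le_one_left hμ₀.le (pow_le_one₀ (by linarith) (by linarith))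
    have hρ' : ∀ i, |ρ i| ≤ s 0 i / 10 := fun i => by
      refine ((hρ i).trans (accumulated_error_le hε hΛ hH hεH hK (by omega) (hs₀ i).1
        (hs₀ i).2)).trans ?_
      have := hs₀p i
      gcongr
      nlinarith
    have hb := iterate_bounds hA hn hs₀p hpos hμk hμk0 hδ hprox hdual hρ' hβ
    -- The loop guard gives μ > Λ⁻², proximity gives xs > μ/2, and x ≤ βH² by the bounds just
    -- obtained.
    have hlow : ∀ i, 1 / (2 * β * H ^ 2 * Λ ^ 2) ≤ s k i := fun i => by
      have h1 := (primalEstimate_mul_bounds hpos hμk hprox i).1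
      have hxp := primalEstimate_pos hpos hμk hprox i
      have h2 := h.guard k hk
      have h3 := (hb i).2
      rw [div_lt_iff₀ (by positivity)] at h2
      have h4 : 1 ≤ s 0 i * H := by
        have := (hs₀ i).1
        rwa [div_le_iff₀ hH0] at this
      rw [div_le_iff₀ (by positivity)]
      set x := P.primalEstimate (s k) (μ k) i
      have h5 : x ≤ β * H ^ 2 := by
        calc x ≤ x * (s 0 i * H) := le_mul_of_one_le_right hxp.le h4
          _ = x * s 0 i * H := by ring
          _ ≤ β * μ 0 * H := by gcongr
          _ ≤ β * H * H := by gcongr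
          _ = _ := by ring
      calc 1 ≤ μ k * Λ ^ 2 := h2.le
        _ ≤ (2 * (x * s k i)) * Λ ^ 2 := by gcongr; linarith
        _ = s k i * (2 * x * Λ ^ 2) := by ring
        _ ≤ s k i * (2 * (β * H ^ 2) * Λ ^ 2) := by
          have := (hpos i).le
          gcongr
        _ = _ := by ring
    have hhigh : ∀ i, s k i ≤ β * H := fun i => (hb i).1.trans (by gcongr; exact (hs₀ i).2)
    have hβn : 13 * β ≤ Λ ^ 2 := by nlinarith
    have hεsmall : 34 * β * H ^ 2 * Λ ^ 2 * ε ≤ 1 := by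
      calc 34 * β * H ^ 2 * Λ ^ 2 * ε = (34 * β) * (H ^ 2 * Λ ^ 2 * ε) := by ring
        _ ≤ (4 * Λ ^ 2) * (H ^ 2 * Λ ^ 2 * ε) :=
            mul_le_mul_of_nonneg_right (by linarith) (by positivity)
        _ = ε * (H ^ 2 * 4 * Λ ^ 4) := by ring
        _ ≤ ε * (H ^ 2 * H * (Λ ^ 4 * Λ ^ 2)) := by
            have h1 : (1 : ℝ) ≤ Λ ^ 2 := by nlinarith
            rw [mul_assoc (H ^ 2) H]
            rw [mul_assoc (H ^ 2) 4]
            gcongr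
            · linarith
            · exact le_mul_of_one_le_right (by positivity) h1
        _ = ε * (H ^ 3 * Λ ^ 6) := by ring
        _ ≤ 1 := hεH
    have hsol := (h.solve k hk).slack_error hε.le hpos (l := 1 / (2 * β * H ^ 2 * Λ ^ 2))
      (h := β * H) (by rw [le_div_iff₀ (by positivity)]; linarith) hlow hhigh
      (by
        refine le_trans ?_ hεsmall
        have : 1 ≤ H * Λ ^ 2 := by nlinarith
        calc 17 * (β * H) * ε ≤ 34 * (β * H) * ε * (H * Λ ^ 2) := by
              refine (le_mul_of_one_le_right (by positivity) this).trans ?_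
              gcongr
              norm_num
          _ = _ := by ring) (by nlinarith)
    obtain ⟨he1, he2, he3, he4⟩ := hsol
    have hstep := newton_step hA hpos hμk hprox hθ hθ4 hθn he1
    have hsnew : s (k + 1) = fun i => s k i + P.newtonDs (s k) (μ k) i +
        (s k i ^ 2 * dsHat k i - P.newtonDs (s k) (μ k) i) := by
      rw [h.s_step k hk]
      funext i
      simp
    rw [← hsnew, ← h.mu_step k hk] at hstep
    -- The vector w follows the exact Δy, so errors in Δy do not enter ρ.
    refine ⟨⟨fun i => by rw [hsnew]; exact hstep.1 i, hstep.2,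
      fun i => ρ i + (s k i ^ 2 * dsHat k i - P.newtonDs (s k) (μ k) i),
      w - P.newtonDy (s k) (μ k), ?_, ?_⟩, ?_, ?_⟩
    · rw [hsnew, sub_eq_add_neg w, Matrix.mulVec_add, ← newtonDs_eq hA hpos]
      funext i
      have := congrFun hdual i
      simp only [Pi.add_apply] at this ⊢
      rw [this]
      ring
    · intro i
      refine (abs_add_le _ _).trans ?_
      push_cast
      rw [add_mul, one_mul]
      refine add_le_add (hρ i) ((he2 i).trans ?_)
      have h1 := (hb i).1
      have : s k i ^ 2 ≤ β ^ 2 * s 0 i ^ 2 := by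
        rw [← mul_pow]; exact pow_le_pow_left₀ (hpos i).le h1 2
      gcongr
    · rw [Finset.sum_range_succ]
      refine (l2norm_add_le _ _).trans ?_
      push_cast
      rw [add_mul, one_mul]
      refine add_le_add hη ?_
      rwa [← mul_pow]
    · intro j hj
      rcases Nat.lt_succ_iff_lt_or_eq.mp hj with hj | rfl
      · exact hdy j hj
      · exact he4

/-- Exact directions satisfy Δs + AᵀΔy = 0, so each dual error is the slack error plus Aᵀ times the
error in Δy. -/
theorem l2norm_perturbation_le (hA : P.A.rank = m) (hAH : ∑ i, ∑ j, |P.A i j| ≤ H ^ 2)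
    {k : ℕ} (hpos : ∀ j < k, ∀ i, 0 < s j i)
    (hη : l2norm (∑ j ∈ Finset.range k, fun i => s j i ^ 2 * dsHat j i - P.newtonDs (s j) (μ j) i)
      ≤ k * (β ^ 2 * H ^ 2 * ε))
    (hdy : ∀ j < k, l2norm (dy j - P.newtonDy (s j) (μ j)) ≤ ε) :
    l2norm (P.perturbation s dsHat dy k) ≤ k * (β ^ 2 + 1) * (H ^ 2 * ε) := by
  have heq : P.perturbation s dsHat dy k =
      (∑ j ∈ Finset.range k, fun i => s j i ^ 2 * dsHat j i - P.newtonDs (s j) (μ j) i) +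
        ∑ j ∈ Finset.range k, P.Aᵀ *ᵥ (dy j - P.newtonDy (s j) (μ j)) := by
    rw [perturbation, ← Finset.sum_add_distrib]
    refine Finset.sum_congr rfl fun j hj => ?_
    have := newtonDs_eq (μ := μ j) hA (hpos j (Finset.mem_range.mp hj))
    rw [Matrix.mulVec_neg] at this
    rw [dualError, Matrix.mulVec_sub]
    funext i
    have := congrFun this i
    simp only [Pi.neg_apply, Pi.add_apply, Pi.sub_apply] at this ⊢
    linarith
  have hT : l2norm (∑ j ∈ Finset.range k, P.Aᵀ *ᵥ (dy j - P.newtonDy (s j) (μ j)))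
      ≤ k * (H ^ 2 * ε) := by
    refine (l2norm_sum_le _ _).trans ?_
    rw [← nsmul_eq_mul]
    refine (Finset.sum_le_card_nsmul _ _ (H ^ 2 * ε) fun j hj => ?_).trans (by simp)
    refine (l2norm_mulVec_le _ _).trans ?_
    rw [Finset.sum_comm]
    simp only [Matrix.transpose_apply]
    exact mul_le_mul hAH (hdy j (Finset.mem_range.mp hj)) (l2norm_nonneg _) (sq_nonneg H)
  rw [heq]
  refine (l2norm_add_le _ _).trans ((add_le_add hη hT).trans (le_of_eq ?_))
  ring

end Run

end LO

/-! ### Existence of a strictly complementary optimal solution -/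

namespace LO

variable {m n : ℕ} {P : LO m n}

/-- Feasible points near the central path exist for arbitrarily small barrier parameters. -/
theorem exists_central_sequence (hA : P.A.rank = m) (hn : 0 < n) {y₀ : Fin m → ℝ}
    {s₀ : Fin n → ℝ} {μ₀ : ℝ} (hdual : P.Aᵀ *ᵥ y₀ + s₀ = P.c) (hs₀ : ∀ i, 0 < s₀ i) (hμ₀ : 0 < μ₀)
    (hδ : P.proximity s₀ μ₀ < 1 / 2) (k : ℕ) :
    ∃ (y : Fin m → ℝ) (s : Fin n → ℝ), P.Aᵀ *ᵥ y + s = P.c ∧ (∀ i, 0 < s i) ∧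
      P.proximity s ((1 - 1 / (4 * n)) ^ k * μ₀) < 1 / 2 := by
  have hn1 : (1 : ℝ) ≤ n := by exact_mod_cast hn
  have hθ : (1 : ℝ) / (4 * n) ≤ 1 / 4 := by
    rw [div_le_div_iff₀ (by positivity) (by norm_num)]; linarith
  induction k with
  | zero => exact ⟨y₀, s₀, hdual, hs₀, by simpa using hδ⟩
  | succ k ih =>
    obtain ⟨y, s, hys, hs, hprox⟩ := ih
    have hμ : 0 < (1 - 1 / (4 * (n : ℝ))) ^ k * μ₀ := mul_pos (pow_pos (by linarith) k) hμ₀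
    have hstep := newton_step hA hs hμ hprox (θ := 1 / (4 * n)) (by positivity) hθ
      (by field_simp; nlinarith) (e := 0) (by
        simp only [Pi.zero_apply, mul_zero]
        exact l2norm_zero.le.trans (by norm_num))
    simp only [Pi.zero_apply, add_zero] at hstep
    refine ⟨y + P.newtonDy s ((1 - 1 / (4 * n)) ^ k * μ₀), _, ?_, hstep.1, ?_⟩
    · have := newtonDs_eq (μ := (1 - 1 / (4 * n)) ^ k * μ₀) hA hs
      rw [Matrix.mulVec_neg] at this
      rw [Matrix.mulVec_add, ← hys]
      funext i
      have := congrFun this i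
      simp only [Pi.add_apply, Pi.neg_apply] at this ⊢
      linarith
    · have := hstep.2
      rwa [← mul_assoc, ← pow_succ'] at this

/-- A limit point (x', s') of nearly central points is optimal. If both entries vanished at some i₀,
the terms xs - xs' - x's, whose sum is zero by orthogonality, would exceed μ/2 at i₀ and eventually
be at least -μ/(4n) elsewhere, a contradiction. -/
theorem exists_strictly_complementary (hA : P.A.rank = m) (hn : 0 < n) {y₀ : Fin m → ℝ}
    {s₀ : Fin n → ℝ} {μ₀ : ℝ} (hdual : P.Aᵀ *ᵥ y₀ + s₀ = P.c) (hs₀ : ∀ i, 0 < s₀ i) (hμ₀ : 0 < μ₀)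
    (hδ : P.proximity s₀ μ₀ < 1 / 2) : ∃ p ∈ P.optimalSet, ∀ i, 0 < p.1 i ∨ 0 < p.2.2 i := by
  have hn1 : (1 : ℝ) ≤ n := by exact_mod_cast hn
  have hθ : (1 : ℝ) / (4 * n) ≤ 1 / 4 := by
    rw [div_le_div_iff₀ (by positivity) (by norm_num)]; linarith
  have hθ0 : (0 : ℝ) < 1 / (4 * n) := by positivity
  choose y s hys hs hprox using exists_central_sequence hA hn hdual hs₀ hμ₀ hδ
  set μ : ℕ → ℝ := fun k => (1 - 1 / (4 * n)) ^ k * μ₀ 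
  have hμ : ∀ k, 0 < μ k := fun k => mul_pos (pow_pos (by linarith) k) hμ₀
  have hμle : ∀ k, μ k ≤ μ₀ := fun k =>
    mul_le_of_le_one_left hμ₀.le (pow_le_one₀ (by linarith) (by linarith))
  have hμlim : Filter.Tendsto μ Filter.atTop (nhds 0) := by
    have := (tendsto_pow_atTop_nhds_zero_of_lt_one (r := 1 - 1 / (4 * (n : ℝ))) (by linarith)
      (by linarith)).mul_const μ₀
    rwa [zero_mul] at this
  set x : ℕ → Fin n → ℝ := fun k => P.primalEstimate (s k) (μ k) 
  have hx : ∀ k i, 0 < x k i := fun k => primalEstimate_pos (hs k) (hμ k) (hprox k)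
  have hxs : ∀ k i, μ k / 2 < x k i * s k i ∧ x k i * s k i < 3 / 2 * μ k := fun k =>
    primalEstimate_mul_bounds (hs k) (hμ k) (hprox k)
  have hAx : ∀ k, P.A *ᵥ x k = P.b := fun k => mulVec_primalEstimate hA (hs k) (hμ k)
  have hbd : ∀ k i, s k i ≤ 7 * n * s₀ i ∧ x k i * s₀ i ≤ 7 * n * μ₀ := fun k =>
    iterate_bounds (ρ := 0) (w := y₀ - y k) hA hn hs₀ (hs k) (hμ k) (hμle k) hδ (hprox k)
      (by
        rw [Matrix.mulVec_sub, add_zero]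
        have := (hys k).trans hdual.symm
        rw [← sub_eq_zero] at this ⊢
        rw [← this]
        abel)
      (fun i => by have := hs₀ i; simp only [Pi.zero_apply, abs_zero]; positivity) (Or.inr le_rfl)
  have hmem : ∀ k, (x k, s k) ∈ Set.Icc (0 : (Fin n → ℝ) × (Fin n → ℝ))
      (fun i => 7 * n * μ₀ / s₀ i, fun i => 7 * n * s₀ i) := fun k =>
    ⟨⟨fun i => (hx k i).le, fun i => (hs k i).le⟩,
      ⟨fun i => (le_div_iff₀ (hs₀ i)).mpr (hbd k i).2, fun i => (hbd k i).1⟩⟩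
  obtain ⟨⟨x', s'⟩, hlimmem, φ, hφ, hlim⟩ := isCompact_Icc.tendsto_subseq hmem
  have hxlim : Filter.Tendsto (fun k => x (φ k)) Filter.atTop (nhds x') :=
    (continuous_fst.tendsto _).comp hlim
  have hslim : Filter.Tendsto (fun k => s (φ k)) Filter.atTop (nhds s') :=
    (continuous_snd.tendsto _).comp hlim
  have hxi : ∀ i, Filter.Tendsto (fun k => x (φ k) i) Filter.atTop (nhds (x' i)) := fun i =>
    (tendsto_pi_nhds.mp hxlim) i
  have hsi : ∀ i, Filter.Tendsto (fun k => s (φ k) i) Filter.atTop (nhds (s' i)) := fun i =>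
    (tendsto_pi_nhds.mp hslim) i
  have hx'0 : 0 ≤ x' := hlimmem.1.1
  have hs'0 : 0 ≤ s' := hlimmem.1.2
  have hAx' : P.A *ᵥ x' = P.b := by
    have hc : Continuous fun v : Fin n → ℝ => P.A *ᵥ v := by fun_prop
    have := (hc.tendsto x').comp hxlim
    refine tendsto_nhds_unique this ?_
    simp [Function.comp_def, hAx]
  -- Convergence of y is not needed: the range of Aᵀ is closed.
  obtain ⟨y', hy'⟩ : ∃ y', P.Aᵀ *ᵥ y' = P.c - s' := by
    have hcl : IsClosed (LinearMap.range (Matrix.mulVecLin P.Aᵀ) : Set (Fin n → ℝ)) :=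
      Submodule.closed_of_finiteDimensional _
    have : P.c - s' ∈ (LinearMap.range (Matrix.mulVecLin P.Aᵀ) : Set (Fin n → ℝ)) :=
      hcl.mem_of_tendsto (hslim.const_sub P.c) (Filter.Eventually.of_forall fun k =>
        ⟨y (φ k), by rw [Matrix.mulVecLin_apply, ← hys (φ k)]; abel⟩)
    exact this
  have hcomp : ∀ i, x' i * s' i = 0 := fun i => by
    refine tendsto_nhds_unique ((hxi i).mul (hsi i)) ?_
    have h0 := hμlim.comp hφ.tendsto_atTop
    refine squeeze_zero (g := fun k => 3 / 2 * μ (φ k))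
      (fun k => (mul_pos (hx _ i) (hs _ i)).le) (fun k => (hxs _ i).2.le) ?_
    simpa using h0.const_mul (3 / 2)
  refine ⟨(x', y', s'), ⟨⟨hAx', by simp [hy'], hx'0, hs'0⟩, ?_⟩, ?_⟩
  · exact Finset.sum_eq_zero fun i _ => hcomp i
  by_contra hcon
  push Not at hcon
  obtain ⟨i₀, hxi₀, hsi₀⟩ := hcon
  have hxi₀ : x' i₀ = 0 := le_antisymm hxi₀ (hx'0 i₀)
  have hsi₀ : s' i₀ = 0 := le_antisymm hsi₀ (hs'0 i₀)
  -- If x'ᵢ > 0 the term is xs(1 - x'/x) with x'/x → 1, likewise with s when s'ᵢ > 0; if both vanish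
  -- the term is xs > 0.
  have hev : ∀ i, ∀ᶠ k in Filter.atTop, -(μ (φ k) / (4 * n)) ≤
      x (φ k) i * s (φ k) i - x (φ k) i * s' i - x' i * s (φ k) i := by
    intro i
    have hratio : ∀ {u : ℕ → ℝ} {a : ℝ}, 0 < a → Filter.Tendsto u Filter.atTop (nhds a) →
        ∀ᶠ k in Filter.atTop, a / u k ≤ 1 + 1 / (8 * n) := fun {u a} ha hu => by
      have := (tendsto_const_nhds (x := a)).div hu ha.ne'
      rw [div_self ha.ne'] at this
      exact (this.eventually_lt_const (lt_add_of_pos_right 1 (by positivity))).mono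
        fun _ h => h.le
    have hbound : ∀ {k : ℕ} {q : ℝ}, q ≤ 1 + 1 / (8 * n) →
        -(μ (φ k) / (4 * n)) ≤ x (φ k) i * s (φ k) i * (1 - q) := fun {k q} hq => by
      have h1 := (hxs (φ k) i).2
      have h2 := mul_pos (hx (φ k) i) (hs (φ k) i)
      have h3 : -(1 / (8 * (n : ℝ))) ≤ 1 - q := by linarith
      have h4 := mul_le_mul_of_nonneg_left h3 h2.le
      have h5 : x (φ k) i * s (φ k) i * (1 / (8 * n)) ≤ 2 * μ (φ k) * (1 / (8 * n)) := by
        refine mul_le_mul_of_nonneg_right ?_ (by positivity)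
        linarith [hμ (φ k)]
      have h6 : 2 * μ (φ k) * (1 / (8 * n)) = μ (φ k) / (4 * n) := by
        field_simp
        ring
      linarith
    rcases (hx'0 i).lt_or_eq with hpos | hzero
    · have hs0 : s' i = 0 := (mul_eq_zero.mp (hcomp i)).resolve_left hpos.ne'
      filter_upwards [hratio hpos (hxi i)] with k hk
      have := (hx (φ k) i).ne'
      refine (hbound hk).trans (le_of_eq ?_)
      rw [hs0]
      field_simp
      ring
    · rcases (hs'0 i).lt_or_eq with hpos' | hzero'
      · filter_upwards [hratio hpos' (hsi i)] with k hk
        have := (hs (φ k) i).ne'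
        refine (hbound hk).trans (le_of_eq ?_)
        rw [← hzero, Pi.zero_apply]
        field_simp
        ring
      · refine Filter.Eventually.of_forall fun k => ?_
        rw [← hzero, ← hzero', Pi.zero_apply]
        have := mul_pos (hx (φ k) i) (hs (φ k) i)
        have := hμ (φ k)
        have : 0 ≤ μ (φ k) / (4 * n) := by positivity
        linarith
  obtain ⟨k, hk⟩ := (Filter.eventually_all.mpr hev).exists
  have horth : ∑ i, (x (φ k) i * s (φ k) i - x (φ k) i * s' i - x' i * s (φ k) i) = 0 := by
    have h0 : P.A *ᵥ (x (φ k) - x') = 0 := by rw [Matrix.mulVec_sub, hAx, hAx', sub_self]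
    have hd : s (φ k) - s' = P.Aᵀ *ᵥ (y' - y (φ k)) := by
      rw [Matrix.mulVec_sub, hy', ← hys (φ k)]; abel
    rw [← dotProduct_transpose_mulVec_eq_zero h0 (y' - y (φ k)), ← hd, dotProduct]
    refine Finset.sum_congr rfl fun i _ => ?_
    simp only [Pi.sub_apply]
    linear_combination -hcomp i
  rw [← Finset.add_sum_erase _ _ (Finset.mem_univ i₀), hxi₀, hsi₀] at horth
  have hrest : -(n * (μ (φ k) / (4 * n))) ≤ ∑ i ∈ Finset.univ.erase i₀,
      (x (φ k) i * s (φ k) i - x (φ k) i * s' i - x' i * s (φ k) i) := by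
    refine le_trans ?_ (Finset.card_nsmul_le_sum _ _ _ fun i _ => hk i)
    rw [nsmul_eq_mul, mul_neg, neg_le_neg_iff]
    have := hμ (φ k)
    gcongr
    calc (Finset.univ.erase i₀).card ≤ (Finset.univ : Finset (Fin n)).card :=
          Finset.card_le_card (Finset.erase_subset _ _)
      _ = n := by simp
  have h1 : (n : ℝ) * (μ (φ k) / (4 * n)) = μ (φ k) / 4 := by field_simp
  have h2 := (hxs (φ k) i₀).1
  have h3 := hμ (φ k)
  linarith

end LO

/-! ### Minimal supports, Cramer's rule, subdeterminant bounds and column spans -/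

/-- A nonnegative vector `v` can be moved within `v + W`, without losing in coordinate `i`, to one
whose support contains the support of no nonzero vector of `W`. -/
theorem exists_minimal_support {ι : Type*} [Fintype ι] (W : Submodule ℝ (ι → ℝ)) (i : ι)
    (v : ι → ℝ) (hv : 0 ≤ v) (hrec : ∀ w ∈ W, 0 ≤ w → (∀ j, v j = 0 → w j = 0) → w = 0) :
    ∃ v', v' - v ∈ W ∧ 0 ≤ v' ∧ (∀ j, v j = 0 → v' j = 0) ∧ v i ≤ v' i ∧
      ∀ w ∈ W, (∀ j, v' j = 0 → w j = 0) → w = 0 := by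
  classical
  induction hc : (Finset.univ.filter fun j => v j ≠ 0).card using Nat.strong_induction_on
    generalizing v with
  | _ c ih =>
  by_cases hmin : ∀ w ∈ W, (∀ j, v j = 0 → w j = 0) → w = 0
  · exact ⟨v, by simp, hv, fun _ h => h, le_rfl, hmin⟩
  push Not at hmin
  obtain ⟨w, hwW, hwv, hw0, hwi⟩ : ∃ w ∈ W, (∀ j, v j = 0 → w j = 0) ∧ w ≠ 0 ∧ 0 ≤ w i := by
    obtain ⟨w, hwW, hwv, hw0⟩ := hmin
    rcases le_total 0 (w i) with h | h
    · exact ⟨w, hwW, hwv, hw0, h⟩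
    · exact ⟨-w, W.neg_mem hwW, fun j hj => by simp [hwv j hj], neg_ne_zero.mpr hw0,
        by simpa using h⟩
  have hneg : (Finset.univ.filter fun j => w j < 0).Nonempty := by
    by_contra hne
    rw [Finset.not_nonempty_iff_eq_empty, Finset.filter_eq_empty_iff] at hne
    exact hw0 (hrec w hwW (fun j => not_lt.mp (hne (Finset.mem_univ j))) hwv)
  -- Ratio test: the longest step along w that keeps v nonnegative annihilates coordinate j, so the
  -- support shrinks. The sign of w was chosen so that coordinate i does not decrease.
  obtain ⟨j, hj, hjmin⟩ := Finset.exists_min_image _ (fun j => v j / (-w j)) hneg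
  have hwj : w j < 0 := (Finset.mem_filter.mp hj).2
  have hvj : v j ≠ 0 := fun h => hwj.ne (hwv j h)
  set t := v j / (-w j) with ht
  have ht0 : 0 ≤ t := div_nonneg (hv j) (by linarith)
  have hu0 : 0 ≤ v + t • w := fun l => by
    simp only [Pi.zero_apply, Pi.add_apply, Pi.smul_apply, smul_eq_mul]
    rcases le_or_gt 0 (w l) with h | h
    · have := hv l
      simp only [Pi.zero_apply] at this
      positivity
    · have := hjmin l (Finset.mem_filter.mpr ⟨Finset.mem_univ l, h⟩)
      rw [le_div_iff₀ (by linarith)] at this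
      linarith
  have huv : ∀ l, v l = 0 → (v + t • w) l = 0 := fun l hl => by simp [hl, hwv l hl]
  have huj : (v + t • w) j = 0 := by
    have : w j ≠ 0 := hwj.ne
    simp only [Pi.add_apply, Pi.smul_apply, smul_eq_mul, ht]
    field_simp
    ring
  have hlt : (Finset.univ.filter fun l => (v + t • w) l ≠ 0).card < c := by
    rw [← hc]
    refine Finset.card_lt_card ⟨fun l hl => ?_, fun h => ?_⟩
    · simp only [Finset.mem_filter, Finset.mem_univ, true_and] at hl ⊢
      exact fun h => hl (huv l h)
    · have := h (Finset.mem_filter.mpr ⟨Finset.mem_univ j, hvj⟩)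
      exact (Finset.mem_filter.mp this).2 huj
  obtain ⟨v', h1, h2, h3, h4, h5⟩ := ih _ hlt (v + t • w) hu0
    (fun w' hw' hw'0 hs => hrec w' hw' hw'0 fun l hl => hs l (huv l hl)) rfl
  refine ⟨v', ?_, h2, fun l hl => h3 l (huv l hl), ?_, h5⟩
  · have := W.add_mem h1 (W.smul_mem t hwW)
    have heq : v' - v = v' - (v + t • w) + t • w := by abel
    rwa [heq]
  · refine le_trans ?_ h4
    simp only [Pi.add_apply, Pi.smul_apply, smul_eq_mul]
    have := mul_nonneg ht0 hwi
    linarith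

namespace Matrix

variable {m n : ℕ} {R : Type*} [CommRing R]

/-- If the columns of `A` in `Z` span, then independent columns in `B ⊆ Z` extend to independent
columns spanning those in `B`, and these extend to a nonsingular square submatrix inside `Z`. -/
theorem exists_nonsingular_submatrix (A : Matrix (Fin m) (Fin n) ℝ) {J₀ B Z : Set (Fin n)}
    (hJ₀ : LinearIndepOn ℝ A.col J₀) (hJB : J₀ ⊆ B) (hBZ : B ⊆ Z)
    (hZ : Submodule.span ℝ (A.col '' Z) = ⊤) :
    ∃ (J : Set (Fin n)) (g : Fin m → Fin n), J₀ ⊆ J ∧ J ⊆ B ∧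
      (∀ j ∈ B, A.col j ∈ Submodule.span ℝ (A.col '' J)) ∧ J ⊆ Set.range g ∧
      (∀ k, g k ∈ Z) ∧ Function.Injective g ∧ (A.submatrix id g).det ≠ 0 := by
  obtain ⟨J, hJB', hJ₀J, hJspan, hJ⟩ := exists_linearIndepOn_extension hJ₀ hJB
  obtain ⟨M, hMZ, hJM, hMspan, hM⟩ := exists_linearIndepOn_extension hJ (hJB'.trans hBZ)
  have hMtop : Submodule.span ℝ (A.col '' M) = ⊤ := by
    rw [eq_top_iff, ← hZ]
    exact Submodule.span_le.mpr hMspan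
  have hcard : Nat.card (Fin m) = Nat.card M := by
    let b := Module.Basis.mk hM (by rw [← hMtop, Set.image_eq_range])
    rw [← Module.finrank_eq_nat_card_basis b]
    simp
  obtain ⟨e⟩ : Nonempty (Fin m ≃ M) := Finite.card_eq.mp hcard
  refine ⟨J, fun k => e k, hJ₀J, hJB', fun j hj => hJspan ⟨j, hj, rfl⟩, fun j hj => ?_,
    fun k => hMZ (e k).2, Subtype.val_injective.comp e.injective, ?_⟩
  · exact ⟨e.symm ⟨j, hJM hj⟩, by simp⟩
  · have hli : LinearIndependent ℝ (A.submatrix id fun k => (e k : Fin n)).col :=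
      hM.comp e e.injective
    rw [Matrix.linearIndependent_cols_iff_isUnit, Matrix.isUnit_iff_isUnit_det] at hli
    exact hli.ne_zero

theorem cramer_submatrix_col (A : Matrix (Fin m) (Fin n) R) (g : Fin m → Fin n) (j : Fin n)
    (k : Fin m) : (A.submatrix id g).cramer (A.col j) k =
      (A.submatrix id (Function.update g k j)).det := by
  rw [Matrix.cramer_apply]
  congr 1
  ext a b
  rcases eq_or_ne b k with rfl | h
  · simp [Matrix.col]
  · simp [h]

theorem det_submatrix_mul_apply (A : Matrix (Fin m) (Fin n) R) {g : Fin m → Fin n}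
    (hg : Function.Injective g) {u : Fin n → R} (hu : ∀ j, j ∉ Set.range g → u j = 0) (k : Fin m) :
    (A.submatrix id g).det * u (g k) = (A.submatrix id g).cramer (A *ᵥ u) k := by
  have h1 : A *ᵥ u = A.submatrix id g *ᵥ (u ∘ g) := by
    funext i
    simp only [Matrix.mulVec, dotProduct, Matrix.submatrix_apply, id, Function.comp_apply]
    exact (Fintype.sum_of_injective g hg _ _ (fun j hj => by simp [hu j hj]) fun _ => rfl).symm
  rw [h1, Matrix.cramer_eq_adjugate_mulVec, Matrix.mulVec_mulVec, Matrix.adjugate_mul,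
    Matrix.smul_mulVec, Matrix.one_mulVec]
  rfl

/-- Cramer numerators are linear in the right-hand side, so for A u they are bounded by the entries
of u times subdeterminants of A. -/
theorem cramer_mulVec (A : Matrix (Fin m) (Fin n) R) (g : Fin m → Fin n) (u : Fin n → R)
    (k : Fin m) : (A.submatrix id g).cramer (A *ᵥ u) k =
      ∑ j, u j * (A.submatrix id (Function.update g k j)).det := by
  have : A *ᵥ u = ∑ j, u j • A.col j := by
    funext i
    simp [Matrix.mulVec, dotProduct, Matrix.col, mul_comm]
  rw [this, map_sum, Finset.sum_apply]
  refine Finset.sum_congr rfl fun j _ => ?_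
  rw [map_smul, Pi.smul_apply, cramer_submatrix_col, smul_eq_mul]

/-- Dual form of Cramer's rule: an element of the row space is determined by its values on the
columns of a basis. -/
theorem det_submatrix_mul_transpose_mulVec (A : Matrix (Fin m) (Fin n) R) (g : Fin m → Fin n)
    (y : Fin m → R) (j : Fin n) : (A.submatrix id g).det * (Aᵀ *ᵥ y) j =
      ∑ k, (Aᵀ *ᵥ y) (g k) * (A.submatrix id (Function.update g k j)).det := by
  have h1 := Matrix.mulVec_cramer (A.submatrix id g) (A.col j)
  have h2 : (Aᵀ *ᵥ y) j = y ⬝ᵥ A.col j := by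
    simp [Matrix.mulVec, dotProduct, Matrix.col, mul_comm]
  rw [h2, ← smul_eq_mul, ← dotProduct_smul, ← h1, Matrix.dotProduct_mulVec, dotProduct]
  refine Finset.sum_congr rfl fun k _ => ?_
  rw [cramer_submatrix_col]
  congr 1
  simp [Matrix.mulVec, Matrix.vecMul, dotProduct, mul_comm]

/-- Enlarging the Leibniz sum from permutations to all maps turns it into a product of column sums.
-/
theorem abs_det_le_prod_sum (M : Matrix (Fin m) (Fin m) ℤ) :
    |M.det| ≤ ∏ k, ∑ i, |M i k| := by
  classical
  have hperm : ∀ σ : Equiv.Perm (Fin m), |Equiv.Perm.sign σ • ∏ k, M (σ k) k| =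
      ∏ k, |M (σ k) k| := fun σ => by
    rw [← Finset.abs_prod]
    rcases Int.units_eq_one_or (Equiv.Perm.sign σ) with h | h <;> simp [h]
  calc |M.det| ≤ ∑ σ : Equiv.Perm (Fin m), ∏ k, |M (σ k) k| := by
        rw [Matrix.det_apply]
        refine (Finset.abs_sum_le_sum_abs _ _).trans (le_of_eq ?_)
        exact Finset.sum_congr rfl fun σ _ => hperm σ
    _ = ∑ p ∈ Finset.univ.image fun σ : Equiv.Perm (Fin m) => (σ : Fin m → Fin m),
        ∏ k, |M (p k) k| := by
        rw [Finset.sum_image fun σ _ τ _ h => DFunLike.coe_injective h]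
    _ ≤ ∑ p : Fin m → Fin m, ∏ k, |M (p k) k| :=
        Finset.sum_le_sum_of_subset_of_nonneg (Finset.subset_univ _)
          fun p _ _ => Finset.prod_nonneg fun k _ => abs_nonneg _
    _ = ∏ k, ∑ i, |M i k| := by
        rw [Finset.prod_univ_sum, Fintype.piFinset_univ]

theorem sum_le_prod_add_one {ι : Type*} [Fintype ι] (f : ι → ℤ) (hf : ∀ i, 0 ≤ f i) :
    ∑ i, f i ≤ ∏ i, (f i + 1) := by
  classical
  have : ∀ s : Finset ι, ∑ i ∈ s, f i + 1 ≤ ∏ i ∈ s, (f i + 1) := fun s => by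
    induction s using Finset.induction_on with
    | empty => simp
    | insert a s ha ih =>
      rw [Finset.sum_insert ha, Finset.prod_insert ha]
      have h1 := Finset.sum_nonneg fun i (_ : i ∈ s) => hf i
      nlinarith [hf a]
  linarith [this Finset.univ]

/-- For injective g each column of A is used at most once, so its factor occurs once in the product;
a repeated column makes the determinant zero. -/
theorem abs_det_submatrix_le (A : Matrix (Fin m) (Fin n) ℤ) (g : Fin m → Fin n) :
    |(A.submatrix id g).det| ≤ ∏ i, ∏ j, (|A i j| + 1) := by
  classical
  by_cases hg : Function.Injective g
  · rw [Finset.prod_comm]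
    refine (abs_det_le_prod_sum _).trans ?_
    calc ∏ k, ∑ i, |A i (g k)| ≤ ∏ k, ∏ i, (|A i (g k)| + 1) := by
          refine Finset.prod_le_prod (fun k _ => Finset.sum_nonneg fun i _ => abs_nonneg _)
            fun k _ => ?_
          exact sum_le_prod_add_one _ fun i => abs_nonneg _
      _ = ∏ j ∈ Finset.univ.image g, ∏ i, (|A i j| + 1) := by
          rw [Finset.prod_image fun a _ b _ h => hg h]
      _ ≤ ∏ j, ∏ i, (|A i j| + 1) := by
          refine Finset.prod_le_prod_of_subset_of_one_le (Finset.subset_univ _)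
            (fun j _ => Finset.prod_nonneg fun i _ => by positivity) fun j _ _ => ?_
          exact Finset.one_le_prod fun i _ => by simp
  · rw [Function.not_injective_iff] at hg
    obtain ⟨a, b, hab, hne⟩ := hg
    rw [Matrix.det_zero_of_column_eq hne fun i => by simp [hab]]
    simp
    positivity

end Matrix

namespace Matrix

variable {m n : ℕ} {A : Matrix (Fin m) (Fin n) ℝ}

theorem linearCombination_col (A : Matrix (Fin m) (Fin n) ℝ) (l : Fin n →₀ ℝ) :
    Finsupp.linearCombination ℝ A.col l = A *ᵥ l := by
  rw [Finsupp.linearCombination_apply, Finsupp.sum_fintype _ _ (by simp)]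
  funext i
  simp [Matrix.mulVec, dotProduct, Matrix.col, mul_comm]

theorem mem_span_col_image {S : Set (Fin n)} {f : Fin m → ℝ} :
    f ∈ Submodule.span ℝ (A.col '' S) ↔ ∃ u : Fin n → ℝ, (∀ j ∉ S, u j = 0) ∧ A *ᵥ u = f := by
  rw [Finsupp.mem_span_image_iff_linearCombination]
  constructor
  · rintro ⟨l, hl, rfl⟩
    refine ⟨l, fun j hj => ?_, (linearCombination_col A l).symm⟩
    by_contra h
    exact hj (hl (Finsupp.mem_support_iff.mpr h))
  · rintro ⟨u, hu, rfl⟩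
    refine ⟨Finsupp.equivFunOnFinite.symm u, fun j hj => ?_, ?_⟩
    · by_contra h
      exact (Finsupp.mem_support_iff.mp hj) (by simpa using hu j h)
    · rw [linearCombination_col]; rfl

theorem linearIndepOn_col_iff {S : Set (Fin n)} : LinearIndepOn ℝ A.col S ↔
    ∀ u : Fin n → ℝ, (∀ j ∉ S, u j = 0) → A *ᵥ u = 0 → u = 0 := by
  rw [linearIndepOn_iff]
  constructor
  · intro h u hu hAu
    have := h (Finsupp.equivFunOnFinite.symm u) (fun j hj => by
      by_contra h
      exact (Finsupp.mem_support_iff.mp hj) (by simpa using hu j h))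
      (by rw [linearCombination_col]; exact hAu)
    funext j
    exact DFunLike.congr_fun this j
  · intro h l hl h0
    rw [linearCombination_col] at h0
    exact DFunLike.coe_injective (h l (fun j hj => by
      by_contra h
      exact hj (hl (Finsupp.mem_support_iff.mpr h))) h0)

theorem transpose_mulVec_eq_zero (hA : A.rank = m) {v : Fin m → ℝ} (hv : Aᵀ *ᵥ v = 0) : v = 0 := by
  have hli : LinearIndependent ℝ A.row := by
    rw [linearIndependent_iff_card_eq_finrank_span, Set.finrank, ← Matrix.rank_eq_finrank_span_row,
      hA, Fintype.card_fin]
  rw [Matrix.mulVec_transpose] at hv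
  exact Matrix.vecMul_injective_iff.mpr hli (hv.trans (Matrix.zero_vecMul _).symm)

/-- A proper span is annihilated by a nonzero functional, that is, by a nonzero v for which Aᵀv
vanishes on S. -/
theorem span_col_image_eq_top {S : Set (Fin n)}
    (h : ∀ v : Fin m → ℝ, (∀ j ∈ S, (Aᵀ *ᵥ v) j = 0) → v = 0) :
    Submodule.span ℝ (A.col '' S) = ⊤ := by
  by_contra hne
  obtain ⟨f, hf0, hf⟩ := Submodule.exists_le_ker_of_lt_top _ (lt_top_iff_ne_top.mpr hne)
  have hfeq : ∀ w, f w = ∑ i, w i * f (Pi.single i 1) := fun w => by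
    rw [LinearMap.pi_apply_eq_sum_univ f w]
    refine Finset.sum_congr rfl fun i _ => ?_
    rw [smul_eq_mul]
    congr 2
    funext j
    simp [Pi.single_apply, eq_comm]
  have hv := h (fun i => f (Pi.single i 1)) fun j hj => by
    have h1 : f (A.col j) = 0 := hf (Submodule.subset_span ⟨j, hj, rfl⟩)
    rw [hfeq] at h1
    simpa [Matrix.mulVec, dotProduct, Matrix.col] using h1
  refine hf0 (LinearMap.ext fun w => ?_)
  rw [hfeq]
  exact Finset.sum_eq_zero fun i _ => by
    rw [show f (Pi.single i 1) = 0 from congrFun hv i, mul_zero]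

end Matrix

/-! ### Optimal pairs, optimal vertices and repair of small entries -/

namespace LO

variable {m n : ℕ} {P : LO m n}

theorem dotProduct_sub_eq_zero {x x' s s' : Fin n → ℝ} {y y' : Fin m → ℝ} (hx : P.A *ᵥ x = P.b)
    (hx' : P.A *ᵥ x' = P.b) {c : Fin n → ℝ} (hs : P.Aᵀ *ᵥ y + s = c) (hs' : P.Aᵀ *ᵥ y' + s' = c) :
    ∑ i, (x i - x' i) * (s i - s' i) = 0 := by
  have h0 : P.A *ᵥ (x - x') = 0 := by rw [Matrix.mulVec_sub, hx, hx', sub_self]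
  have hd : s - s' = P.Aᵀ *ᵥ (y' - y) := by
    rw [Matrix.mulVec_sub, eq_sub_of_add_eq' hs, eq_sub_of_add_eq' hs']; abel
  exact (congrArg (fun w => (x - x') ⬝ᵥ w) hd).trans (dotProduct_transpose_mulVec_eq_zero h0 _)

theorem mul_eq_zero_of_mem_optimalSet {p : (Fin n → ℝ) × (Fin m → ℝ) × (Fin n → ℝ)}
    (hp : p ∈ P.optimalSet) (i : Fin n) : p.1 i * p.2.2 i = 0 := by
  obtain ⟨⟨-, -, hx, hs⟩, h⟩ := hp
  exact (Finset.sum_eq_zero_iff_of_nonneg fun j _ => mul_nonneg (hx j) (hs j)).mp h i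
    (Finset.mem_univ i)

/-- In the orthogonality relation of two optimal pairs the products within a pair vanish; the cross
products are nonnegative and sum to zero. -/
theorem cross_mul_eq_zero {p q : (Fin n → ℝ) × (Fin m → ℝ) × (Fin n → ℝ)}
    (hp : p ∈ P.optimalSet) (hq : q ∈ P.optimalSet) (i : Fin n) : p.1 i * q.2.2 i = 0 := by
  have h := dotProduct_sub_eq_zero hp.1.1 hq.1.1 hp.1.2.1 hq.1.2.1
  have hnn : ∀ i, 0 ≤ p.1 i * q.2.2 i + q.1 i * p.2.2 i := fun i =>
    add_nonneg (mul_nonneg (hp.1.2.2.1 i) (hq.1.2.2.2 i)) (mul_nonneg (hq.1.2.2.1 i) (hp.1.2.2.2 i))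
  have h0 : ∑ i, (p.1 i * q.2.2 i + q.1 i * p.2.2 i) = 0 := by
    rw [← neg_eq_zero, ← h, ← Finset.sum_neg_distrib]
    refine Finset.sum_congr rfl fun i _ => ?_
    linear_combination -mul_eq_zero_of_mem_optimalSet hp i - mul_eq_zero_of_mem_optimalSet hq i
  have := (Finset.sum_eq_zero_iff_of_nonneg fun j _ => hnn j).mp h0 i (Finset.mem_univ i)
  have h1 : 0 ≤ p.1 i * q.2.2 i := mul_nonneg (hp.1.2.2.1 i) (hq.1.2.2.2 i)
  have h2 : 0 ≤ q.1 i * p.2.2 i := mul_nonneg (hq.1.2.2.1 i) (hp.1.2.2.2 i)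
  linarith

theorem slack_eq_zero_of_mem_partitionB {p : (Fin n → ℝ) × (Fin m → ℝ) × (Fin n → ℝ)}
    (hp : p ∈ P.optimalSet) {i : Fin n} (hi : i ∈ P.partitionB) : p.2.2 i = 0 := by
  obtain ⟨q, hq, hqi⟩ := hi
  exact (mul_eq_zero.mp (cross_mul_eq_zero hq hp i)).resolve_left hqi.ne'

theorem primal_eq_zero_of_mem_partitionN {p : (Fin n → ℝ) × (Fin m → ℝ) × (Fin n → ℝ)}
    (hp : p ∈ P.optimalSet) {i : Fin n} (hi : i ∈ P.partitionN) : p.1 i = 0 := by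
  obtain ⟨q, hq, hqi⟩ := hi
  exact (mul_eq_zero.mp (cross_mul_eq_zero hp hq i)).resolve_right hqi.ne'

/-- Minimal support is applied to ker A. A nonnegative w in ker A supported where p.1 is positive
has wᵀc = 0 by complementarity, and wᵀc = wᵀs₀ with s₀ > 0, so w = 0. Shrinking the support keeps
complementarity. -/
theorem exists_optimal_primal_vertex {y₀ : Fin m → ℝ} {s₀ : Fin n → ℝ}
    (hdual : P.Aᵀ *ᵥ y₀ + s₀ = P.c) (hs₀ : ∀ i, 0 < s₀ i)
    {p : (Fin n → ℝ) × (Fin m → ℝ) × (Fin n → ℝ)} (hp : p ∈ P.optimalSet) (i : Fin n) :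
    ∃ x, (x, p.2) ∈ P.optimalSet ∧ p.1 i ≤ x i ∧ LinearIndepOn ℝ P.A.col {j | x j ≠ 0} := by
  obtain ⟨x, hxW, hx0, hxs, hxi, hmin⟩ := exists_minimal_support
    (LinearMap.ker (Matrix.mulVecLin P.A)) i p.1 hp.1.2.2.1 (by
      intro w hw hw0 hsupp
      have hAw : P.A *ᵥ w = 0 := hw
      have h1 : w ⬝ᵥ P.c = 0 := by
        rw [← hp.1.2.1, dotProduct_add, dotProduct_transpose_mulVec_eq_zero hAw, zero_add]
        refine Finset.sum_eq_zero fun j _ => ?_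
        rcases mul_eq_zero.mp (mul_eq_zero_of_mem_optimalSet hp j) with h | h
        · rw [hsupp j h, zero_mul]
        · rw [h, mul_zero]
      rw [← hdual, dotProduct_add, dotProduct_transpose_mulVec_eq_zero hAw, zero_add] at h1
      funext j
      have := (Finset.sum_eq_zero_iff_of_nonneg fun j _ => mul_nonneg (hw0 j) (hs₀ j).le).mp h1 j
        (Finset.mem_univ j)
      exact (mul_eq_zero.mp this).resolve_right (hs₀ j).ne')
  refine ⟨x, ⟨⟨?_, hp.1.2.1, hx0, hp.1.2.2.2⟩, ?_⟩, hxi, ?_⟩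
  · have : P.A *ᵥ (x - p.1) = 0 := hxW
    rwa [Matrix.mulVec_sub, hp.1.1, sub_eq_zero] at this
  · refine Finset.sum_eq_zero fun j _ => ?_
    rcases mul_eq_zero.mp (mul_eq_zero_of_mem_optimalSet hp j) with h | h
    · simp [hxs j h]
    · simp [h]
  · rw [Matrix.linearIndepOn_col_iff]
    intro u hu hAu
    exact hmin u hAu fun j hj => hu j (by simpa using hj)

/-- The mirror image, with range Aᵀ for ker A and the positive solution x₀ for s₀. Minimality of the
support of s means that the columns where s vanishes span. -/
theorem exists_optimal_dual_vertex (hA : P.A.rank = m) {x₀ : Fin n → ℝ} (hAx₀ : P.A *ᵥ x₀ = P.b)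
    (hx₀ : ∀ i, 0 < x₀ i) {p : (Fin n → ℝ) × (Fin m → ℝ) × (Fin n → ℝ)} (hp : p ∈ P.optimalSet)
    (j : Fin n) : ∃ y s, (p.1, y, s) ∈ P.optimalSet ∧ p.2.2 j ≤ s j ∧
      Submodule.span ℝ (P.A.col '' {i | s i = 0}) = ⊤ := by
  obtain ⟨s, ⟨v, hv⟩, hs0, hss, hsj, hmin⟩ := exists_minimal_support
    (LinearMap.range (Matrix.mulVecLin P.Aᵀ)) j p.2.2 hp.1.2.2.2 (by
      rintro _ ⟨v, rfl⟩ hw0 hsupp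
      simp only [Matrix.mulVecLin_apply] at hw0 hsupp ⊢
      have h1 : (p.1 - x₀) ⬝ᵥ (P.Aᵀ *ᵥ v) = 0 :=
        dotProduct_transpose_mulVec_eq_zero (by rw [Matrix.mulVec_sub, hp.1.1, hAx₀, sub_self]) v
      have h2 : p.1 ⬝ᵥ (P.Aᵀ *ᵥ v) = 0 := Finset.sum_eq_zero fun i _ => by
        rcases mul_eq_zero.mp (mul_eq_zero_of_mem_optimalSet hp i) with h | h
        · rw [h, zero_mul]
        · rw [hsupp i h, mul_zero]
      rw [sub_dotProduct, h2, zero_sub, neg_eq_zero] at h1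
      funext i
      have := (Finset.sum_eq_zero_iff_of_nonneg fun i _ => mul_nonneg (hx₀ i).le (hw0 i)).mp h1 i
        (Finset.mem_univ i)
      exact (mul_eq_zero.mp this).resolve_left (hx₀ i).ne')
  rw [Matrix.mulVecLin_apply] at hv
  refine ⟨p.2.1 - v, s, ⟨⟨hp.1.1, ?_, hp.1.2.2.1, hs0⟩, ?_⟩, hsj, ?_⟩
  · rw [Matrix.mulVec_sub, hv, ← hp.1.2.1]
    abel
  · refine Finset.sum_eq_zero fun i _ => ?_
    rcases mul_eq_zero.mp (mul_eq_zero_of_mem_optimalSet hp i) with h | h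
    · simp [h]
    · simp [hss i h]
  · refine Matrix.span_col_image_eq_top fun u hu => Matrix.transpose_mulVec_eq_zero hA ?_
    exact hmin _ ⟨u, rfl⟩ hu

/-- Replacing the entries outside `T` of a solution of `A x = b` by zero changes the others little
if the columns in `T` are spanned by part of a nonsingular square submatrix. -/
theorem exists_primal_repair {x x' : Fin n → ℝ} (hx : P.A *ᵥ x = P.b) (hx' : P.A *ᵥ x' = P.b)
    {T J : Set (Fin n)} {g : Fin m → Fin n} (hx'T : ∀ j ∉ T, x' j = 0) (hJT : J ⊆ T)
    (hspan : ∀ j ∈ T, P.A.col j ∈ Submodule.span ℝ (P.A.col '' J)) (hJg : J ⊆ Set.range g)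
    (hg : Function.Injective g) (hdet : (P.A.submatrix id g).det ≠ 0) {D : ℝ}
    (hD : ∀ h : Fin m → Fin n, |(P.A.submatrix id h).det| ≤ D) {a : ℝ} (ha : ∀ j ∉ T, |x j| ≤ a)
    (ha0 : 0 ≤ a) :
    ∃ z : Fin n → ℝ, P.A *ᵥ z = P.b ∧ (∀ j ∉ T, z j = 0) ∧
      ∀ j ∈ T, |z j - x j| ≤ n * a * D / |(P.A.submatrix id g).det| := by
  classical
  have hD0 : 0 ≤ D := (abs_nonneg _).trans (hD g)
  set u : Fin n → ℝ := fun j => if j ∈ T then 0 else x j with hu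
  have hua : ∀ j, |u j| ≤ a := fun j => by
    by_cases hj : j ∈ T
    · simpa [hu, hj] using ha0
    · simpa [hu, hj] using ha j hj
  -- Here u is the part of x to be removed. Both x' and x - u are supported in T, and A maps their
  -- difference to A u.
  have hmem : P.A *ᵥ u ∈ Submodule.span ℝ (P.A.col '' J) := by
    have h1 : P.A *ᵥ u ∈ Submodule.span ℝ (P.A.col '' T) := by
      refine Matrix.mem_span_col_image.mpr ⟨x' - (x - u), fun j hj => ?_, ?_⟩
      · simp [hu, hj, hx'T j hj]
      · rw [Matrix.mulVec_sub, Matrix.mulVec_sub, hx, hx']; abel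
    refine (Submodule.span_le.mpr ?_) h1
    rintro _ ⟨j, hj, rfl⟩
    exact hspan j hj
  obtain ⟨w, hwJ, hAw⟩ := Matrix.mem_span_col_image.mp hmem
  have hw : ∀ j, |w j| ≤ n * a * D / |(P.A.submatrix id g).det| := fun j => by
    by_cases hj : j ∈ Set.range g
    · obtain ⟨k, rfl⟩ := hj
      rw [le_div_iff₀ (abs_pos.mpr hdet), mul_comm, ← abs_mul,
        Matrix.det_submatrix_mul_apply P.A hg (fun j hj => hwJ j fun h => hj (hJg h)), hAw,
        Matrix.cramer_mulVec]
      refine (Finset.abs_sum_le_sum_abs _ _).trans ?_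
      refine (Finset.sum_le_card_nsmul _ _ (a * D) fun j _ => ?_).trans (by simp [mul_assoc])
      rw [abs_mul]
      exact mul_le_mul (hua j) (hD _) (abs_nonneg _) ha0
    · rw [hwJ j fun h => hj (hJg h), abs_zero]
      positivity
  refine ⟨x - u + w, ?_, fun j hj => ?_, fun j hj => ?_⟩
  · rw [Matrix.mulVec_add, Matrix.mulVec_sub, hAw, hx]; abel
  · simp [hu, hj, hwJ j fun h => hj (hJT h)]
  · simpa [hu, hj] using hw j

/-- The entries in `T` of an approximate dual slack can be replaced by zero in a similar way. -/
theorem exists_dual_repair {y y' : Fin m → ℝ} {s s' ρ : Fin n → ℝ}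
    (hs : P.Aᵀ *ᵥ y + s = P.c + ρ) (hs' : P.Aᵀ *ᵥ y' + s' = P.c)
    {T J : Set (Fin n)} {g : Fin m → Fin n} (hs'T : ∀ j ∈ T, s' j = 0) (hJT : J ⊆ T)
    (hspan : ∀ j ∈ T, P.A.col j ∈ Submodule.span ℝ (P.A.col '' J)) (hJg : J ⊆ Set.range g)
    (hdet : (P.A.submatrix id g).det ≠ 0) {D : ℝ}
    (hD : ∀ h : Fin m → Fin n, |(P.A.submatrix id h).det| ≤ D) {a r : ℝ} (ha : ∀ j ∈ T, |s j| ≤ a)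
    (ha0 : 0 ≤ a) (hr : ∀ j, |ρ j| ≤ r) (hmn : m ≤ n) (hr0 : 0 ≤ r) :
    ∃ q : (Fin m → ℝ) × (Fin n → ℝ), P.Aᵀ *ᵥ q.1 + q.2 = P.c ∧ (∀ j ∈ T, q.2 j = 0) ∧
      ∀ j, |q.2 j - s j| ≤ r + n * (a + r) * D / |(P.A.submatrix id g).det| := by
  classical
  have hD0 : 0 ≤ D := (abs_nonneg _).trans (hD g)
  -- The target correction: it cancels the unperturbed slack s - ρ on J and vanishes on the other
  -- basis columns.
  set v : Fin m → ℝ := fun k => if g k ∈ J then s (g k) - ρ (g k) else 0 with hv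
  have hva : ∀ k, |v k| ≤ a + r := fun k => by
    by_cases hk : g k ∈ J
    · simp only [hv, hk, if_true]
      exact (abs_sub _ _).trans (add_le_add (ha _ (hJT hk)) (hr _))
    · simp only [hv, hk, if_false, abs_zero]
      positivity
  obtain ⟨z, hz⟩ : ∃ z : Fin m → ℝ, ∀ k, (P.Aᵀ *ᵥ z) (g k) = v k := by
    refine ⟨((P.A.submatrix id g)ᵀ)⁻¹ *ᵥ v, fun k => ?_⟩
    have : (P.A.submatrix id g)ᵀ *ᵥ (((P.A.submatrix id g)ᵀ)⁻¹ *ᵥ v) = v := by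
      rw [Matrix.mulVec_mulVec, Matrix.mul_nonsing_inv _
        (by rw [Matrix.det_transpose]; exact hdet.isUnit), Matrix.one_mulVec]
    exact congrFun this k
  have hbound : ∀ j, |(P.Aᵀ *ᵥ z) j| ≤ n * (a + r) * D / |(P.A.submatrix id g).det| := fun j => by
    rw [le_div_iff₀ (abs_pos.mpr hdet), mul_comm, ← abs_mul,
      Matrix.det_submatrix_mul_transpose_mulVec]
    refine (Finset.abs_sum_le_sum_abs _ _).trans ?_
    refine (Finset.sum_le_card_nsmul _ _ ((a + r) * D) fun k _ => ?_).trans ?_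
    · rw [abs_mul, hz]
      exact mul_le_mul (hva k) (hD _) (abs_nonneg _) (by positivity)
    · rw [Finset.card_univ, Fintype.card_fin, nsmul_eq_mul, mul_assoc]
      have : (m : ℝ) ≤ n := by exact_mod_cast hmn
      gcongr
  have hq : P.Aᵀ *ᵥ (y + z) + (s - ρ - P.Aᵀ *ᵥ z) = P.c := by
    rw [Matrix.mulVec_add, eq_sub_of_add_eq hs]; abel
  refine ⟨(y + z, s - ρ - P.Aᵀ *ᵥ z), hq, fun j hj => ?_, fun j => ?_⟩
  -- The difference from s' lies in the row space and vanishes on J, hence on every column in T,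
  -- since those are combinations of columns in J.
  · have hd : ∀ i, s i - ρ i - (P.Aᵀ *ᵥ z) i - s' i = (P.Aᵀ *ᵥ (y' - (y + z))) i := fun i => by
      have h1 := congrFun hq i
      have h2 := congrFun hs' i
      rw [Matrix.mulVec_sub]
      simp only [Pi.add_apply, Pi.sub_apply] at h1 h2 ⊢
      linarith
    have hJ0 : ∀ i ∈ J, (P.Aᵀ *ᵥ (y' - (y + z))) i = 0 := fun i hi => by
      rw [← hd, hs'T i (hJT hi)]
      obtain ⟨k, rfl⟩ := hJg hi
      rw [hz]
      simp [hv, hi]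
    obtain ⟨w, hw, hAw⟩ := Matrix.mem_span_col_image.mp (hspan j hj)
    have h3 : (P.Aᵀ *ᵥ (y' - (y + z))) j = 0 := by
      have h4 : (P.Aᵀ *ᵥ (y' - (y + z))) j = (P.A *ᵥ w) ⬝ᵥ (y' - (y + z)) := by
        rw [hAw]; rfl
      rw [h4, ← Matrix.vecMul_transpose, ← Matrix.dotProduct_mulVec]
      refine Finset.sum_eq_zero fun i _ => ?_
      by_cases hi : i ∈ J
      · rw [hJ0 i hi, mul_zero]
      · rw [hw i hi, zero_mul]
    have h5 := hd j
    rw [h3, hs'T j hj, sub_zero] at h5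
    exact h5
  · have : s j - ρ j - (P.Aᵀ *ᵥ z) j - s j = -ρ j - (P.Aᵀ *ᵥ z) j := by ring
    simp only [Pi.sub_apply]
    rw [this]
    refine (abs_sub _ _).trans ?_
    rw [abs_neg]
    exact add_le_add (hr j) (hbound j)

end LO

/-! ### Least squares and rounding for integer data -/

/-- A nonempty closed set contains a point closest to a given one. -/
theorem exists_isMinOn_l2norm_sub {ι : Type*} [Fintype ι] {S : Set (ι → ℝ)} (hS : IsClosed S)
    (hne : S.Nonempty) (a : ι → ℝ) : ∃ u ∈ S, IsMinOn (fun v => l2norm (v - a)) S u := by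
  have hS' : IsClosed ((fun v : EuclideanSpace ℝ ι => v.ofLp) ⁻¹' S) :=
    hS.preimage (PiLp.continuous_ofLp 2 _)
  obtain ⟨u₀, hu₀⟩ := hne
  obtain ⟨u, hu, hmin⟩ := hS'.exists_infDist_eq_dist ⟨WithLp.toLp 2 u₀, hu₀⟩ (WithLp.toLp 2 a)
  refine ⟨u.ofLp, hu, fun v hv => ?_⟩
  have h1 := Metric.infDist_le_dist_of_mem (x := WithLp.toLp 2 a)
    (show WithLp.toLp 2 v ∈ (fun v : EuclideanSpace ℝ ι => v.ofLp) ⁻¹' S from hv)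
  rw [hmin, dist_comm, dist_eq_norm, dist_comm, dist_eq_norm] at h1
  exact h1

/-- Outside T both vectors are zero and contribute equally to the two distances, so the comparison
of norms survives restriction to T. -/
theorem abs_sub_le_of_l2norm_sub_le {ι : Type*} [Fintype ι] {u v a : ι → ℝ} {T : Set ι}
    (hu : ∀ j ∉ T, u j = 0) (hv : ∀ j ∉ T, v j = 0) (h : l2norm (u - a) ≤ l2norm (v - a)) {e : ℝ}
    (he : ∀ j ∈ T, |v j - a j| ≤ e) {i : ι} (hi : i ∈ T) : |u i - a i| ≤ Fintype.card ι * e := by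
  classical
  set u' : ι → ℝ := fun j => if j ∈ T then u j - a j else 0 with hu'
  set v' : ι → ℝ := fun j => if j ∈ T then v j - a j else 0 with hv'
  have he0 : 0 ≤ e := (abs_nonneg _).trans (he i hi)
  have hsq : ∑ j, (u j - a j) ^ 2 ≤ ∑ j, (v j - a j) ^ 2 := by
    have := pow_le_pow_left₀ (l2norm_nonneg _) h 2
    rwa [l2norm_sq, l2norm_sq] at this
  have hle : l2norm u' ≤ l2norm v' := by
    refine l2norm_le_of_sq_le (l2norm_nonneg _) ?_
    rw [l2norm_sq, ← sub_nonpos, ← Finset.sum_sub_distrib]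
    rw [← sub_nonpos, ← Finset.sum_sub_distrib] at hsq
    refine le_trans (le_of_eq (Finset.sum_congr rfl fun j _ => ?_)) hsq
    by_cases hj : j ∈ T
    · simp [hu', hv', hj]
    · simp [hu', hv', hj, hu j hj, hv j hj]
  calc |u i - a i| = |u' i| := by simp [hu', hi]
    _ ≤ l2norm u' := abs_apply_le_l2norm _ _
    _ ≤ l2norm v' := hle
    _ ≤ ∑ j, |v' j| := l2norm_le_sum_abs _
    _ ≤ ∑ _j : ι, e := Finset.sum_le_sum fun j _ => by
        by_cases hj : j ∈ T
        · simpa [hv', hj] using he j hj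
        · simpa [hv', hj] using he0
    _ = Fintype.card ι * e := by simp

namespace IntLO

variable {m n : ℕ} {I : IntLO m n}

theorem det_submatrix_toLO (I : IntLO m n) (g : Fin m → Fin n) :
    (I.toLO.A.submatrix id g).det = ((I.A.submatrix id g).det : ℝ) := by
  rw [Int.cast_det]
  rfl

/-- A positive entry of an optimal primal solution can be made at least the reciprocal of the
determinant of a nonsingular square submatrix. -/
theorem exists_primal_basis (hA : I.toLO.A.rank = m) {y₀ : Fin m → ℝ} {s₀ : Fin n → ℝ}
    (hdual : I.toLO.Aᵀ *ᵥ y₀ + s₀ = I.toLO.c) (hs₀ : ∀ i, 0 < s₀ i) {i : Fin n}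
    (hi : i ∈ I.toLO.partitionB) :
    ∃ (J : Set (Fin n)) (g : Fin m → Fin n), J ⊆ I.toLO.partitionB ∧
      (∀ j ∈ I.toLO.partitionB, I.toLO.A.col j ∈ Submodule.span ℝ (I.toLO.A.col '' J)) ∧
      J ⊆ Set.range g ∧ Function.Injective g ∧ (I.toLO.A.submatrix id g).det ≠ 0 ∧
      ∃ p ∈ I.toLO.optimalSet, 1 ≤ |(I.toLO.A.submatrix id g).det| * p.1 i := by
  obtain ⟨q, hq, hqi⟩ := hi
  obtain ⟨x, hx, hxi, hli⟩ := LO.exists_optimal_primal_vertex hdual hs₀ hq i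
  have hxi0 : 0 < x i := hqi.trans_le hxi
  obtain ⟨J, g, hJ₀, hJB, hspan, hJg, -, hg, hdet⟩ := Matrix.exists_nonsingular_submatrix I.toLO.A
    hli (B := I.toLO.partitionB) (Z := Set.univ)
    (fun j hj => ⟨_, hx, lt_of_le_of_ne (hx.1.2.2.1 j) (Ne.symm hj)⟩) (Set.subset_univ _)
    (Matrix.span_col_image_eq_top fun v hv => Matrix.transpose_mulVec_eq_zero hA
      (funext fun j => hv j (Set.mem_univ j)))
  refine ⟨J, g, hJB, hspan, hJg, hg, hdet, _, hx, ?_⟩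
  have hxJ : ∀ j, j ∉ Set.range g → x j = 0 := fun j hj => by
    by_contra h
    exact hj (hJg (hJ₀ h))
  obtain ⟨k, rfl⟩ : i ∈ Set.range g := by
    by_contra h
    exact hxi0.ne' (hxJ i h)
  -- By Cramer's rule this product is a determinant with integer entries; being nonzero, it has
  -- absolute value at least 1.
  have hint : (I.toLO.A.submatrix id g).det * x (g k) =
      (((I.A.submatrix id g).updateCol k I.b).det : ℤ) := by
    rw [Matrix.det_submatrix_mul_apply _ hg hxJ, hx.1.1, Matrix.cramer_apply, Int.cast_det]
    congr 1
    ext a b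
    rcases eq_or_ne b k with rfl | h
    · simp [toLO]
    · simp [toLO, h]
  change 1 ≤ _ * x (g k)
  rw [← abs_of_pos hxi0, ← abs_mul, hint, ← Int.cast_abs, ← Int.cast_one, Int.cast_le]
  refine Int.one_le_abs fun h => ?_
  rw [h, Int.cast_zero] at hint
  exact mul_ne_zero hdet hxi0.ne' hint

/-- The analogue of `exists_primal_basis` for the dual slacks. -/
theorem exists_dual_basis (hA : I.toLO.A.rank = m) {x₀ : Fin n → ℝ}
    (hAx₀ : I.toLO.A *ᵥ x₀ = I.toLO.b) (hx₀ : ∀ i, 0 < x₀ i) {j : Fin n}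
    (hj : j ∈ I.toLO.partitionN) :
    ∃ (J : Set (Fin n)) (g : Fin m → Fin n), J ⊆ I.toLO.partitionB ∧
      (∀ j ∈ I.toLO.partitionB, I.toLO.A.col j ∈ Submodule.span ℝ (I.toLO.A.col '' J)) ∧
      J ⊆ Set.range g ∧ (I.toLO.A.submatrix id g).det ≠ 0 ∧
      ∃ p ∈ I.toLO.optimalSet, 1 ≤ |(I.toLO.A.submatrix id g).det| * p.2.2 j := by
  obtain ⟨q, hq, hqj⟩ := hj
  obtain ⟨y, s, hs, hsj, hspanZ⟩ := LO.exists_optimal_dual_vertex hA hAx₀ hx₀ hq j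
  have hsj0 : 0 < s j := hqj.trans_le hsj
  obtain ⟨J, g, -, hJB, hspan, hJg, hgZ, -, hdet⟩ := Matrix.exists_nonsingular_submatrix I.toLO.A
    (linearIndepOn_empty ℝ _) (B := I.toLO.partitionB) (Z := {i | s i = 0}) (Set.empty_subset _)
    (fun i hi => LO.slack_eq_zero_of_mem_partitionB hs hi) hspanZ
  refine ⟨J, g, hJB, hspan, hJg, hdet, _, hs, ?_⟩
  have hy : I.toLO.Aᵀ *ᵥ y = I.toLO.c - s := eq_sub_of_add_eq hs.1.2.1
  -- The basis columns lie where s vanishes, so Aᵀy equals c there and the right-hand side is an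
  -- integer.
  have hint : (I.toLO.A.submatrix id g).det * s j =
      (((I.A.submatrix id g).det * I.c j -
        ∑ k, I.c (g k) * (I.A.submatrix id (Function.update g k j)).det : ℤ) : ℝ) := by
    have h := Matrix.det_submatrix_mul_transpose_mulVec I.toLO.A g y j
    have hg0 : ∀ k, s (g k) = 0 := hgZ
    simp only [hy, Pi.sub_apply, hg0, sub_zero, det_submatrix_toLO] at h
    rw [det_submatrix_toLO]
    simp only [Int.cast_sub, Int.cast_mul, Int.cast_sum]
    simp only [toLO] at h
    linarith
  change 1 ≤ _ * s j
  rw [← abs_of_pos hsj0, ← abs_mul, hint, ← Int.cast_abs, ← Int.cast_one, Int.cast_le]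
  refine Int.one_le_abs fun h => ?_
  rw [h, Int.cast_zero] at hint
  exact mul_ne_zero hdet hsj0.ne' hint

/-- Used with (u, v) = (x, s) on B and (s, x) on N. An optimal entry p ≥ 1/d forces its partner v to
be small through the gap, and uv > μ/2 then forces u to be large. -/
theorem entry_bounds {N μ u v p d : ℝ} (hμ : 0 < μ) (hv : 0 < v) (hu : 0 < u)
    (huv : μ / 2 < u * v) (hgap : v * p ≤ 7 / 4 * N * μ) (hd : 0 ≤ d) (hp : 1 ≤ d * p) :
    v ≤ 7 / 4 * N * μ * d ∧ 2 < 7 * N * d * u := by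
  have h1 : v ≤ 7 / 4 * N * μ * d := by
    calc v ≤ v * (d * p) := le_mul_of_one_le_right hv.le hp
      _ = v * p * d := by ring
      _ ≤ 7 / 4 * N * μ * d := by gcongr
  refine ⟨h1, ?_⟩
  have h2 : μ / 2 < u * (7 / 4 * N * μ * d) := huv.trans_le (by gcongr)
  have h3 : μ * 2 < μ * (7 * N * d * u) := by linarith
  exact lt_of_mul_lt_mul_left h3 hμ.le

/-- A nearly optimal pair close to the central path reveals the optimal partition, and rounding
it gives an optimal solution. -/
theorem rounding_optimal (hA : I.toLO.A.rank = m) (hn : 0 < n) {x₀ : Fin n → ℝ} {y₀ : Fin m → ℝ}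
    {s₀ : Fin n → ℝ} (hdual₀ : I.toLO.Aᵀ *ᵥ y₀ + s₀ = I.toLO.c) (hs₀ : ∀ i, 0 < s₀ i)
    (hAx₀ : I.toLO.A *ᵥ x₀ = I.toLO.b) (hx₀ : ∀ i, 0 < x₀ i)
    (hsc : ∃ p ∈ I.toLO.optimalSet, ∀ i, 0 < p.1 i ∨ 0 < p.2.2 i)
    {x s ρ : Fin n → ℝ} {y : Fin m → ℝ} {μ Λ D : ℝ} (hAx : I.toLO.A *ᵥ x = I.toLO.b)
    (hx : ∀ i, 0 < x i) (hs : ∀ i, 0 < s i) (hdual : I.toLO.Aᵀ *ᵥ y + s = I.toLO.c + ρ)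
    (hμ : 0 < μ) (hΛ : 4 ≤ Λ) (hμΛ : μ * Λ ^ 2 ≤ 1) (hρ : ∀ i, |ρ i| ≤ 1 / Λ ^ 4)
    (hxs : ∀ i, μ / 2 < x i * s i)
    (hgap : ∀ p ∈ I.toLO.optimalSet, ∑ i, (x i * p.2.2 i + p.1 i * s i) ≤ 7 / 4 * n * μ)
    (hD : ∀ h : Fin m → Fin n, |(I.toLO.A.submatrix id h).det| ≤ D) (hDΛ : 4 * n ^ 2 * D ≤ Λ) :
    {i | s i < 1 / Λ} = I.toLO.partitionB ∧ {i | x i < 1 / Λ} = I.toLO.partitionN ∧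
      (∃ p, I.toLO.IsRounding (1 / Λ) x s p) ∧
      ∀ p, I.toLO.IsRounding (1 / Λ) x s p → p ∈ I.toLO.optimalSet := by
  have hn1 : (1 : ℝ) ≤ n := by exact_mod_cast hn
  have hn0 : (0 : ℝ) < n := by linarith
  have hΛ0 : 0 < Λ := by linarith
  obtain ⟨p₀, hp₀, hp₀sc⟩ := hsc
  have hgapx : ∀ p ∈ I.toLO.optimalSet, ∀ i, x i * p.2.2 i ≤ 7 / 4 * n * μ ∧
      s i * p.1 i ≤ 7 / 4 * n * μ := fun p hp i => by
    have hnn : ∀ i, 0 ≤ x i * p.2.2 i ∧ 0 ≤ p.1 i * s i := fun i =>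
      ⟨mul_nonneg (hx i).le (hp.1.2.2.2 i), mul_nonneg (hp.1.2.2.1 i) (hs i).le⟩
    have := (Finset.single_le_sum (f := fun i => x i * p.2.2 i + p.1 i * s i)
      (fun i _ => add_nonneg (hnn i).1 (hnn i).2) (Finset.mem_univ i)).trans (hgap p hp)
    have h1 := hnn i
    constructor
    · linarith
    · rw [mul_comm (s i)]; linarith
  have hB : ∀ i ∈ I.toLO.partitionB, ∃ (J : Set (Fin n)) (g : Fin m → Fin n),
      J ⊆ I.toLO.partitionB ∧
      (∀ j ∈ I.toLO.partitionB, I.toLO.A.col j ∈ Submodule.span ℝ (I.toLO.A.col '' J)) ∧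
      J ⊆ Set.range g ∧ Function.Injective g ∧ (I.toLO.A.submatrix id g).det ≠ 0 ∧
      s i ≤ 7 / 4 * n * μ * D ∧ 2 < 7 * n * |(I.toLO.A.submatrix id g).det| * x i := fun i hi => by
    obtain ⟨J, g, h1, h2, h3, h4, h5, p, hp, hpi⟩ := exists_primal_basis hA hdual₀ hs₀ hi
    have := entry_bounds hμ (hs i) (hx i) (hxs i) (hgapx p hp i).2 (abs_nonneg _) hpi
    refine ⟨J, g, h1, h2, h3, h4, h5, this.1.trans ?_, this.2⟩
    gcongr
    exact hD g
  have hN : ∀ i ∈ I.toLO.partitionN, ∃ (J : Set (Fin n)) (g : Fin m → Fin n),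
      J ⊆ I.toLO.partitionB ∧
      (∀ j ∈ I.toLO.partitionB, I.toLO.A.col j ∈ Submodule.span ℝ (I.toLO.A.col '' J)) ∧
      J ⊆ Set.range g ∧ (I.toLO.A.submatrix id g).det ≠ 0 ∧
      x i ≤ 7 / 4 * n * μ * D ∧ 2 < 7 * n * |(I.toLO.A.submatrix id g).det| * s i := fun i hi => by
    obtain ⟨J, g, h1, h2, h3, h4, p, hp, hpi⟩ := exists_dual_basis hA hAx₀ hx₀ hi
    have := entry_bounds hμ (hx i) (hs i) (by rw [mul_comm]; exact hxs i) (hgapx p hp i).1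
      (abs_nonneg _) hpi
    refine ⟨J, g, h1, h2, h3, h4, this.1.trans ?_, this.2⟩
    gcongr
    exact hD g
  have hBN : ∀ i, i ∈ I.toLO.partitionB ∨ i ∈ I.toLO.partitionN := fun i =>
    (hp₀sc i).imp (fun h => ⟨p₀, hp₀, h⟩) fun h => ⟨p₀, hp₀, h⟩
  have hBNd : ∀ i ∈ I.toLO.partitionB, i ∉ I.toLO.partitionN := fun i hi ⟨p, hp, hpi⟩ =>
    hpi.ne' (LO.slack_eq_zero_of_mem_partitionB hp hi)
  have hD0 : 0 ≤ D := (abs_nonneg _).trans (hD fun k => ⟨0, hn⟩)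
  have hsmall : 7 / 4 * n * μ * D < 1 / Λ := by
    rw [lt_div_iff₀ hΛ0]
    have h1 : 4 * (n : ℝ) * D ≤ Λ := by
      refine le_trans ?_ hDΛ
      gcongr
      exact le_self_pow₀ hn1 two_ne_zero
    calc 7 / 4 * n * μ * D * Λ = 7 / 16 * (4 * n * D) * (μ * Λ) := by ring
      _ ≤ 7 / 16 * Λ * (μ * Λ) := by gcongr
      _ = 7 / 16 * (μ * Λ ^ 2) := by ring
      _ < 1 := by linarith
  have hlarge : ∀ {g : Fin m → Fin n} {u : ℝ}, 0 < u →
      2 < 7 * n * |(I.toLO.A.submatrix id g).det| * u → 1 / Λ ≤ u := fun {g u} hu h => by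
    rw [div_le_iff₀ hΛ0]
    have h1 : 4 * (n : ℝ) * D ≤ Λ := by
      refine le_trans ?_ hDΛ
      gcongr
      exact le_self_pow₀ hn1 two_ne_zero
    have h2 : 7 * n * |(I.toLO.A.submatrix id g).det| * u ≤ 7 * n * D * u := by
      gcongr
      exact hD g
    have h3 : 4 * n * D * u ≤ Λ * u := by gcongr
    nlinarith
  have hsB : {i | s i < 1 / Λ} = I.toLO.partitionB := by
    ext i
    refine ⟨fun hi => ?_, fun hi => ?_⟩
    · refine (hBN i).resolve_right fun h => ?_
      obtain ⟨J, g, -, -, -, -, -, h6⟩ := hN i h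
      exact absurd (hlarge (hs i) h6) (not_le.mpr hi)
    · obtain ⟨J, g, -, -, -, -, -, h6, -⟩ := hB i hi
      exact h6.trans_lt hsmall
  have hxN : {i | x i < 1 / Λ} = I.toLO.partitionN := by
    ext i
    refine ⟨fun hi => ?_, fun hi => ?_⟩
    · refine (hBN i).resolve_left fun h => ?_
      obtain ⟨J, g, -, -, -, -, -, -, h6⟩ := hB i h
      exact absurd (hlarge (hx i) h6) (not_le.mpr hi)
    · obtain ⟨J, g, -, -, -, -, h6, -⟩ := hN i hi
      exact h6.trans_lt hsmall
  have hxN' : ∀ i, x i < 1 / Λ ↔ i ∈ I.toLO.partitionN := fun i => Set.ext_iff.mp hxN i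
  have hsB' : ∀ i, s i < 1 / Λ ↔ i ∈ I.toLO.partitionB := fun i => Set.ext_iff.mp hsB i
  have hBc : ∀ i, i ∉ I.toLO.partitionB ↔ i ∈ I.toLO.partitionN := fun i =>
    ⟨(hBN i).resolve_left, fun h h' => hBNd i h' h⟩
  have hclosed : ∀ v : Fin n → ℝ, IsClosed {w : Fin n → ℝ | ∀ i, v i < 1 / Λ → w i = 0} :=
      fun v => by
    simp only [Set.ofPred_forall]
    exact isClosed_iInter fun i => isClosed_iInter fun _ =>
      isClosed_eq (continuous_apply i) continuous_const
  refine ⟨hsB, hxN, ?_, ?_⟩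
  · obtain ⟨u, hu, humin⟩ := exists_isMinOn_l2norm_sub (S := I.toLO.roundedPrimal (1 / Λ) x) (by
        refine IsClosed.inter (isClosed_eq (by fun_prop) continuous_const) (hclosed x))
      ⟨p₀.1, hp₀.1.1, fun i hi => LO.primal_eq_zero_of_mem_partitionN hp₀ ((hxN' i).mp hi)⟩ x
    -- The dual objective depends on the slack alone, so the minimization runs over slacks and z is
    -- recovered from membership in the range.
    obtain ⟨w, ⟨⟨z, hz⟩, hw⟩, hwmin⟩ := exists_isMinOn_l2norm_sub
      (S := {w | I.toLO.c - w ∈ LinearMap.range (Matrix.mulVecLin I.toLO.Aᵀ)} ∩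
        {w | ∀ i, s i < 1 / Λ → w i = 0}) (by
        refine IsClosed.inter ?_ (hclosed s)
        exact (Submodule.closed_of_finiteDimensional
          (LinearMap.range (Matrix.mulVecLin I.toLO.Aᵀ))).preimage (by fun_prop))
      ⟨p₀.2.2, ⟨p₀.2.1, eq_sub_of_add_eq hp₀.1.2.1⟩,
        fun i hi => LO.slack_eq_zero_of_mem_partitionB hp₀ ((hsB' i).mp hi)⟩ s
    refine ⟨(u, z, w), ⟨hu, humin⟩, ⟨by rw [← Matrix.mulVecLin_apply, hz]; abel, hw⟩, ?_⟩
    intro q hq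
    exact hwmin (show q.2 ∈ _ from ⟨⟨q.1, eq_sub_of_add_eq hq.1⟩, hq.2⟩)
  · rintro ⟨u, z, w⟩ ⟨⟨hu, humin⟩, hzw, hwmin⟩
    have huN : ∀ i ∈ I.toLO.partitionN, u i = 0 := fun i hi => hu.2 i ((hxN' i).mpr hi)
    have hwB : ∀ i ∈ I.toLO.partitionB, w i = 0 := fun i hi => hzw.2 i ((hsB' i).mpr hi)
    have hn2 : (n : ℝ) ^ 2 * (n : ℝ) ^ 2 * (μ * D ^ 2) ≤ 1 / 16 := by
      have h1 : (4 * (n : ℝ) ^ 2 * D) ^ 2 ≤ Λ ^ 2 := by gcongr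
      have h2 := mul_le_mul_of_nonneg_left h1 hμ.le
      linarith
    have ha0 : 0 ≤ 7 / 4 * n * μ * D := by positivity
    have huB : ∀ i ∈ I.toLO.partitionB, 0 < u i := fun i hi => by
      obtain ⟨J, g, hJB, hspan, hJg, hg, hdet, -, h6⟩ := hB i hi
      set d := |(I.toLO.A.submatrix id g).det| with hd
      have hd0 : 0 < d := abs_pos.mpr hdet
      obtain ⟨v, hv, hvN, hvx⟩ := LO.exists_primal_repair hAx hp₀.1.1
        (fun j hj => LO.primal_eq_zero_of_mem_partitionN hp₀ ((hBc j).mp hj)) hJB hspan hJg hg hdet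
        hD (a := 7 / 4 * n * μ * D) (fun j hj => by
          obtain ⟨_, _, -, -, -, -, h, -⟩ := hN j ((hBc j).mp hj)
          rwa [abs_of_pos (hx j)]) ha0
      have hmin : l2norm (u - x) ≤ l2norm (v - x) :=
        humin (show v ∈ _ from ⟨hv, fun j hj => hvN j ((hBc j).mpr ((hxN' j).mp hj))⟩)
      have h7 := abs_sub_le_of_l2norm_sub_le (fun j hj => huN j ((hBc j).mp hj)) hvN hmin hvx hi
      rw [Fintype.card_fin] at h7
      -- The same d bounds x i from below and divides the repair error, so it cancels and only D²
      -- remains. The budget 4n²D ≤ Λ with μΛ² ≤ 1 is exactly of that order; bounding d separately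
      -- would cost D³.
      have h8 : n * (n * (7 / 4 * n * μ * D) * D / d) < x i := by
        have h9 : 7 * n * d * (n * (n * (7 / 4 * n * μ * D) * D / d)) =
            49 / 4 * (n ^ 2 * n ^ 2 * (μ * D ^ 2)) := by
          field_simp
          ring
        have h10 : 7 * n * d * (n * (n * (7 / 4 * n * μ * D) * D / d)) < 7 * n * d * x i := by
          rw [h9]; linarith
        exact lt_of_mul_lt_mul_left h10 (by positivity)
      linarith [(abs_le.mp h7).1]
    have hwN : ∀ i ∈ I.toLO.partitionN, 0 < w i := fun i hi => by
      obtain ⟨J, g, hJB, hspan, hJg, hdet, -, h6⟩ := hN i hi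
      set d := |(I.toLO.A.submatrix id g).det| with hd
      have hd0 : 0 < d := abs_pos.mpr hdet
      have hmn : m ≤ n := by
        rw [← hA]; simpa using Matrix.rank_le_card_width I.toLO.A
      obtain ⟨q, hq, hqB, hqs⟩ := LO.exists_dual_repair hdual hp₀.1.2.1
        (fun j hj => LO.slack_eq_zero_of_mem_partitionB hp₀ hj) hJB hspan hJg hdet
        hD (a := 7 / 4 * n * μ * D) (r := 1 / Λ ^ 4) (fun j hj => by
          obtain ⟨_, _, -, -, -, -, -, h, -⟩ := hB j hj
          rwa [abs_of_pos (hs j)]) ha0 hρ hmn (by positivity)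
      have hmin : l2norm (w - s) ≤ l2norm (q.2 - s) :=
        hwmin (show q ∈ _ from ⟨hq, fun j hj => hqB j ((hsB' j).mp hj)⟩)
      have h7 := abs_sub_le_of_l2norm_sub_le (T := I.toLO.partitionN)
        (fun j hj => hwB j ((hBN j).resolve_right hj))
        (fun j hj => hqB j ((hBN j).resolve_right hj)) hmin (fun j _ => hqs j) hi
      rw [Fintype.card_fin] at h7
      have h8 : n * (1 / Λ ^ 4 + n * (7 / 4 * n * μ * D + 1 / Λ ^ 4) * D / d) < s i := by
        have h9 : 7 * n * d * (n * (1 / Λ ^ 4 + n * (7 / 4 * n * μ * D + 1 / Λ ^ 4) * D / d)) =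
            49 / 4 * (n ^ 2 * n ^ 2 * (μ * D ^ 2)) + 7 * (n ^ 2 * d) * (1 / Λ ^ 4)
              + 7 * n * (n ^ 2 * D) * (1 / Λ ^ 4) := by
          field_simp
          ring
        have hnD : (n : ℝ) ^ 2 * D ≤ Λ / 4 := by linarith
        have hnd : (n : ℝ) ^ 2 * d ≤ Λ / 4 := le_trans (by gcongr; exact hD g) hnD
        have hD1 : 1 ≤ D := by
          have h11 : (1 : ℝ) ≤ d := by
            rw [hd, det_submatrix_toLO, ← Int.cast_abs, ← Int.cast_one, Int.cast_le]
            refine Int.one_le_abs fun h => hdet ?_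
            rw [det_submatrix_toLO, h, Int.cast_zero]
          exact h11.trans (hD g)
        have hnΛ : (n : ℝ) ≤ Λ / 4 := by nlinarith
        have h12 : 7 * (n ^ 2 * d) * (1 / Λ ^ 4) ≤ 7 / 256 := by
          calc 7 * (n ^ 2 * d) * (1 / Λ ^ 4) ≤ 7 * (Λ / 4) * (1 / Λ ^ 4) := by gcongr
            _ = 7 / 4 / Λ ^ 3 := by field_simp
            _ ≤ 7 / 4 / 4 ^ 3 := by gcongr
            _ = _ := by norm_num
        have h13 : 7 * n * (n ^ 2 * D) * (1 / Λ ^ 4) ≤ 7 / 256 := by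
          calc 7 * n * (n ^ 2 * D) * (1 / Λ ^ 4) ≤ 7 * (Λ / 4) * (Λ / 4) * (1 / Λ ^ 4) := by gcongr
            _ = 7 / 16 / Λ ^ 2 := by field_simp; norm_num
            _ ≤ 7 / 16 / 4 ^ 2 := by gcongr
            _ = _ := by norm_num
        have h10 : 7 * n * d * (n * (1 / Λ ^ 4 + n * (7 / 4 * n * μ * D + 1 / Λ ^ 4) * D / d))
            < 7 * n * d * s i := by
          rw [h9]; linarith
        exact lt_of_mul_lt_mul_left h10 (by positivity)
      linarith [(abs_le.mp h7).1]
    refine ⟨⟨hu.1, hzw.1, fun i => ?_, fun i => ?_⟩, Finset.sum_eq_zero fun i _ => ?_⟩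
    · exact (hBN i).elim (fun h => (huB i h).le) fun h => (huN i h).ge
    · exact (hBN i).elim (fun h => (hwB i h).ge) fun h => (hwN i h).le
    · exact (hBN i).elim (fun h => by simp [hwB i h]) fun h => by simp [huN i h]

end IntLO

/-! ### The optimality gap of an inexact iterate -/

namespace LO

variable {m n : ℕ} {P : LO m n}

theorem optimal_primal_bound (hA : P.A.rank = m) {y₀ : Fin m → ℝ} {s₀ : Fin n → ℝ} {μ₀ β : ℝ}
    (hdual : P.Aᵀ *ᵥ y₀ + s₀ = P.c) (hs₀ : ∀ i, 0 < s₀ i) (hμ₀ : 0 < μ₀)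
    (hδ₀ : P.proximity s₀ μ₀ < 1 / 2) (hβ : (m = 0 ∧ 6 / 5 ≤ β) ∨ 7 * (n : ℝ) ≤ β)
    {p : (Fin n → ℝ) × (Fin m → ℝ) × (Fin n → ℝ)} (hp : p ∈ P.optimalSet) (i : Fin n) :
    p.1 i * s₀ i ≤ β * μ₀ := by
  rcases hβ with ⟨hm, hβ⟩ | hβ
  · subst hm
    have hz : ∀ v : Fin 0 → ℝ, P.Aᵀ *ᵥ v = 0 := fun v => by
      funext i; simp [Matrix.mulVec, dotProduct]
    have h1 : p.2.2 i = s₀ i := by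
      have := hp.1.2.1.trans hdual.symm
      rw [hz, hz, zero_add, zero_add] at this
      rw [this]
    have h2 := mul_eq_zero_of_mem_optimalSet hp i
    rw [h1] at h2
    rw [h2]
    positivity
  · have hx₀ := primalEstimate_pos hs₀ hμ₀ hδ₀
    have horth := dotProduct_sub_eq_zero (mulVec_primalEstimate hA hs₀ hμ₀) hp.1.1 hdual hp.1.2.1
    have hpx : ∀ j, 0 ≤ p.1 j := hp.1.2.2.1
    have hps : ∀ j, 0 ≤ p.2.2 j := hp.1.2.2.2
    have hsum : ∑ j, p.1 j * s₀ j ≤ ∑ _j : Fin n, 3 / 2 * μ₀ := by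
      have heq : ∑ j, (p.1 j * s₀ j - 3 / 2 * μ₀) = ∑ j, (p.1 j * s₀ j - 3 / 2 * μ₀ +
          (P.primalEstimate s₀ μ₀ j - p.1 j) * (s₀ j - p.2.2 j)) := by
        rw [Finset.sum_add_distrib, horth, add_zero]
      rw [← sub_nonpos, ← Finset.sum_sub_distrib, heq]
      refine Finset.sum_nonpos fun j _ => ?_
      have h1 := (primalEstimate_mul_bounds hs₀ hμ₀ hδ₀ j).2
      have h2 := mul_nonneg (hx₀ j).le (hps j)
      have h3 := mul_eq_zero_of_mem_optimalSet hp j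
      nlinarith
    have h4 := (Finset.single_le_sum (f := fun j => p.1 j * s₀ j)
      (fun j _ => mul_nonneg (hpx j) (hs₀ j).le) (Finset.mem_univ i)).trans hsum
    rw [Finset.sum_const, Finset.card_univ, Fintype.card_fin, nsmul_eq_mul] at h4
    have h5 : 7 * (n : ℝ) * μ₀ ≤ β * μ₀ := by gcongr
    have h6 : (0 : ℝ) ≤ n * μ₀ := by positivity
    linarith

/-- The slack s - ρ satisfies the unperturbed dual equation, so it is orthogonally comparable with
any optimal pair; the two ρ terms add μ/8 each to 3/2 μ. -/
theorem optimality_gap_le {y₀ : Fin m → ℝ} {x s₀ s ρ : Fin n → ℝ} {w : Fin m → ℝ} {μ : ℝ}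
    (hdual₀ : P.Aᵀ *ᵥ y₀ + s₀ = P.c) (hx : P.A *ᵥ x = P.b) (hdual : s = s₀ + ρ + P.Aᵀ *ᵥ w)
    (hxs : ∀ i, x i * s i < 3 / 2 * μ) (hx0 : ∀ i, 0 < x i) (hxρ : ∀ i, x i * |ρ i| ≤ μ / 8)
    {p : (Fin n → ℝ) × (Fin m → ℝ) × (Fin n → ℝ)} (hp : p ∈ P.optimalSet)
    (hpρ : ∀ i, p.1 i * |ρ i| ≤ μ / 8) :
    ∑ i, (x i * p.2.2 i + p.1 i * s i) ≤ 7 / 4 * n * μ := by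
  have hd : P.Aᵀ *ᵥ (y₀ - w) + (s - ρ) = P.c := by
    rw [hdual, Matrix.mulVec_sub, ← hdual₀]; abel
  have horth := dotProduct_sub_eq_zero hx hp.1.1 hd hp.1.2.1
  have hsum : ∑ i, (x i * p.2.2 i + p.1 i * s i) ≤ ∑ _i : Fin n, 7 / 4 * μ := by
    rw [← sub_nonpos, ← Finset.sum_sub_distrib]
    have : ∑ i, (x i * p.2.2 i + p.1 i * s i - 7 / 4 * μ) =
        ∑ i, (x i * p.2.2 i + p.1 i * s i - 7 / 4 * μ +
          (x i - p.1 i) * ((s - ρ) i - p.2.2 i)) := by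
      rw [Finset.sum_add_distrib, horth, add_zero]
    rw [this]
    refine Finset.sum_nonpos fun i _ => ?_
    have h1 := mul_eq_zero_of_mem_optimalSet hp i
    have h2 := mul_le_mul_of_nonneg_left (neg_abs_le (ρ i)) (hx0 i).le
    have h3 := mul_le_mul_of_nonneg_left (le_abs_self (ρ i)) (hp.1.2.2.1 i)
    have h4 := hxρ i
    have h5 := hpρ i
    have h6 := hxs i
    rw [Pi.sub_apply]
    nlinarith
  refine hsum.trans (le_of_eq ?_)
  rw [Finset.sum_const, Finset.card_univ, Fintype.card_fin, nsmul_eq_mul]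
  ring

end LO

/-! ### Iteration count and its absorption into powers of two -/

/-- The number of passes of a loop that multiplies `μ` by `1 - θ`. -/
theorem iteration_count_le {θ κ N ℓ μ₀ : ℝ} {K : ℕ} (hκ : 1 ≤ κ) (hN : 0 < N) (hℓ : 0 ≤ ℓ)
    (hμ₀ : 0 < μ₀) (hμH : μ₀ ≤ 2 ^ (κ * ℓ)) (hθ : 1 / (4 * κ * N) ≤ θ) (hθ1 : θ ≤ 1)
    (h : ∀ k < K, (2 : ℝ) ^ (-(2 * ℓ)) < (1 - θ) ^ k * μ₀) :
    (K : ℝ) ≤ 1 + 14 / 5 * (κ * (κ + 2)) * (N * ℓ) := by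
  -- The guard is known only for k = K - 1, hence the summand 1. The factor 14/5 is 4 · 7/10 with
  -- log 2 < 7/10.
  rcases K with _ | k
  · rw [Nat.cast_zero]; positivity
  have h1 := h k (Nat.lt_succ_self k)
  have h2 : (1 - θ) ^ k ≤ Real.exp (-(θ * k)) := by
    calc (1 - θ) ^ k ≤ Real.exp (-θ) ^ k := by
          refine pow_le_pow_left₀ (by linarith) (Real.one_sub_le_exp_neg θ) k
      _ = Real.exp (-(θ * k)) := by rw [← Real.exp_nat_mul]; congr 1; ring
  have h3 : (2 : ℝ) ^ (-(2 * ℓ)) < Real.exp (-(θ * k)) * 2 ^ (κ * ℓ) := by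
    refine h1.trans_le (mul_le_mul h2 hμH hμ₀.le (Real.exp_pos _).le)
  rw [Real.rpow_def_of_pos two_pos, Real.rpow_def_of_pos two_pos, ← Real.exp_add,
    Real.exp_lt_exp] at h3
  have h4 := Real.log_two_lt_d9
  have h5 : θ * k ≤ 7 / 10 * ((κ + 2) * ℓ) := by
    have : Real.log 2 * ((κ + 2) * ℓ) ≤ 7 / 10 * ((κ + 2) * ℓ) := by
      gcongr
      linarith
    nlinarith
  have h6 : k ≤ 4 * κ * N * (θ * k) := by
    have h7 : 1 ≤ 4 * κ * N * θ := by
      rw [div_le_iff₀ (by positivity)] at hθ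
      linarith
    have := mul_le_mul_of_nonneg_right h7 (Nat.cast_nonneg (α := ℝ) k)
    linarith
  have h8 : 4 * κ * N * (θ * k) ≤ 4 * κ * N * (7 / 10 * ((κ + 2) * ℓ)) := by gcongr
  push_cast
  linarith

/-- Moves the dependence of the iteration count on κ into 2^((κ-1)L), using L ≥ 2, so that no
constant depending on κ enters the precision condition. With d = κ - 1 the left side is 3 + 4d + d²,
and log 4 ≥ 4/3 suffices in the quadratic bound for exp. -/
theorem quadratic_le_four_rpow {κ : ℝ} (hκ : 1 ≤ κ) : κ * (κ + 2) ≤ 3 * 4 ^ (κ - 1) := by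
  have h1 : (0 : ℝ) ≤ κ - 1 := by linarith
  have hlog : (4 / 3 : ℝ) ≤ Real.log 4 := by
    have : Real.log 4 = 2 * Real.log 2 := by
      rw [show (4 : ℝ) = 2 ^ 2 by norm_num, Real.log_pow]; norm_num
    linarith [Real.log_two_gt_d9]
  have h2 : 4 / 3 * (κ - 1) ≤ Real.log 4 * (κ - 1) := by gcongr
  have h3 := Real.quadratic_le_exp_of_nonneg (x := Real.log 4 * (κ - 1)) (by positivity)
  rw [Real.rpow_def_of_pos (by norm_num)]
  have h4 : (4 / 3 * (κ - 1)) ^ 2 ≤ (Real.log 4 * (κ - 1)) ^ 2 := by gcongr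
  nlinarith [sq_nonneg (κ - 1)]

theorem two_mul_le_two_pow {n : ℕ} (hn : 0 < n) : 2 * (n : ℝ) ≤ 2 ^ n := by
  induction n, hn using Nat.le_induction with
  | base => norm_num
  | succ k hk ih =>
    have : (1 : ℝ) ≤ k := by exact_mod_cast hk
    push_cast
    rw [pow_succ]
    linarith

/-- The case β = 6/5, with L = a + 2 and n ≤ L/2. -/
theorem count_poly_le_of_zero (a : ℕ) :
    (1 + 21 / 5 * ((a : ℝ) + 2) ^ 2) * ((6 / 5) ^ 2 + 1) ≤ 8 ^ (a + 2) := by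
  have h : 1 + 21 / 5 * ((a : ℝ) + 2) ^ 2 ≤ 89 / 5 * 8 ^ a := by
    induction a with
    | zero => norm_num
    | succ a ih =>
      push_cast
      rw [pow_succ (8 : ℝ)]
      nlinarith [Nat.cast_nonneg (α := ℝ) a]
  rw [pow_add]
  nlinarith [pow_pos (show (0 : ℝ) < 8 by norm_num) a]

/-- The case β = 7n, with L = a + 4 and n ≤ (L - 2)/2. -/
theorem count_poly_le (a : ℕ) :
    (1 + 21 / 5 * (((a : ℝ) + 2) * (a + 4))) * (49 / 4 * ((a : ℝ) + 2) ^ 2 + 1) ≤ 8 ^ (a + 4) := by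
  have h1 : 1 + 21 / 5 * (((a : ℝ) + 2) * (a + 4)) ≤ 173 / 5 * 2 ^ a := by
    induction a with
    | zero => norm_num
    | succ a ih =>
      push_cast
      rw [pow_succ (2 : ℝ)]
      nlinarith [Nat.cast_nonneg (α := ℝ) a]
  have h2 : 49 / 4 * ((a : ℝ) + 2) ^ 2 + 1 ≤ 50 * 4 ^ a := by
    clear h1
    induction a with
    | zero => norm_num
    | succ a ih =>
      push_cast
      rw [pow_succ (4 : ℝ)]
      nlinarith [Nat.cast_nonneg (α := ℝ) a]
  calc _ ≤ (173 / 5 * 2 ^ a) * (50 * 4 ^ a : ℝ) := by gcongr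
    _ = 1730 * 8 ^ a := by
      rw [show (8 : ℝ) = 2 * 4 by norm_num, mul_pow]; ring
    _ ≤ 8 ^ (a + 4) := by
      rw [pow_add]
      nlinarith [pow_pos (show (0 : ℝ) < 8 by norm_num) a]

/-- The iteration count is dominated by the slack in the input length. -/
theorem iteration_count_mul_le {n ℓ : ℕ} {κ β k : ℝ} (hκ : 1 ≤ κ) (hn : 0 < n)
    (hβ : (β = 6 / 5 ∧ 2 * n ≤ ℓ) ∨ (β = 7 * n ∧ 2 * n + 2 ≤ ℓ))
    (hk : k ≤ 1 + 14 / 5 * (κ * (κ + 2)) * (√n * ℓ)) :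
    k * (β ^ 2 + 1) ≤ 2 ^ (κ * ℓ) * (2 ^ (ℓ : ℝ)) ^ 2 := by
  have hn1 : (1 : ℝ) ≤ n := by exact_mod_cast hn
  have hℓ2 : (2 : ℝ) ≤ ℓ := by
    have : 2 ≤ ℓ := by omega
    exact_mod_cast this
  have hsqrt : √(n : ℝ) ≤ n := by
    rw [Real.sqrt_le_left (by linarith)]
    nlinarith
  have hpow : (4 : ℝ) ^ (κ - 1) ≤ 2 ^ ((κ - 1) * ℓ) := by
    rw [show (4 : ℝ) = 2 ^ (2 : ℝ) by norm_num, ← Real.rpow_mul (by norm_num)]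
    refine Real.rpow_le_rpow_of_exponent_le (by norm_num) ?_
    nlinarith
  have hX1 : (1 : ℝ) ≤ 2 ^ ((κ - 1) * ℓ) :=
    Real.one_le_rpow (by norm_num) (mul_nonneg (by linarith) (by linarith))
  set X : ℝ := 2 ^ ((κ - 1) * ℓ)
  have hsplit : (2 : ℝ) ^ (κ * ℓ) * (2 ^ (ℓ : ℝ)) ^ 2 = X * 8 ^ ℓ := by
    have h1 : (2 : ℝ) ^ (κ * ℓ) = X * 2 ^ (ℓ : ℝ) := by
      rw [← Real.rpow_add two_pos]; congr 1; ring
    have h2 : (8 : ℝ) ^ ℓ = (2 ^ ℓ) ^ 3 := by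
      rw [← pow_mul, mul_comm, pow_mul]; norm_num
    rw [h1, Real.rpow_natCast, h2]
    ring
  have hk2 : k ≤ X * (1 + 42 / 5 * (n * ℓ)) := by
    have h1 : κ * (κ + 2) ≤ 3 * X := (quadratic_le_four_rpow hκ).trans (by gcongr)
    have h2 : 14 / 5 * (κ * (κ + 2)) * (√n * ℓ) ≤ 14 / 5 * (3 * X) * (n * ℓ) := by gcongr
    linarith
  have hpoly : (1 + 42 / 5 * ((n : ℝ) * ℓ)) * (β ^ 2 + 1) ≤ 8 ^ ℓ := by
    rcases hβ with ⟨rfl, hℓ⟩ | ⟨rfl, hℓ⟩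
    · obtain ⟨a, rfl⟩ := Nat.exists_eq_add_of_le' (show 2 ≤ ℓ by omega)
      refine le_trans ?_ (count_poly_le_of_zero a)
      have h1 : 2 * (n : ℝ) ≤ (a : ℝ) + 2 := by exact_mod_cast hℓ
      push_cast
      have h2 : 42 / 5 * ((n : ℝ) * (a + 2)) ≤ 21 / 5 * ((a : ℝ) + 2) ^ 2 := by nlinarith
      gcongr
    · obtain ⟨a, rfl⟩ := Nat.exists_eq_add_of_le' (show 4 ≤ ℓ by omega)
      refine le_trans ?_ (count_poly_le a)
      have h1 : 2 * (n : ℝ) ≤ (a : ℝ) + 2 := by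
        have : 2 * n ≤ a + 2 := by omega
        exact_mod_cast this
      push_cast
      have h2 : 42 / 5 * ((n : ℝ) * (a + 4)) ≤ 21 / 5 * (((a : ℝ) + 2) * (a + 4)) := by nlinarith
      have h3 : (7 * (n : ℝ)) ^ 2 ≤ 49 / 4 * ((a : ℝ) + 2) ^ 2 := by nlinarith
      gcongr
  rw [hsplit]
  calc k * (β ^ 2 + 1) ≤ X * (1 + 42 / 5 * (n * ℓ)) * (β ^ 2 + 1) := by gcongr
    _ = X * ((1 + 42 / 5 * (n * ℓ)) * (β ^ 2 + 1)) := by ring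
    _ ≤ X * 8 ^ ℓ := by gcongr

/-! ### Lower bounds on the input length -/

namespace IntLO

variable {m n : ℕ} {I : IntLO m n}

theorem prod_add_one_le (I : IntLO m n) : ∏ i, ∏ j, (|I.A i j| + 1) ≤
    2 ^ (∑ i, ∑ j, Nat.clog 2 ((I.A i j).natAbs + 1)) := by
  rw [← Finset.prod_pow_eq_pow_sum]
  refine Finset.prod_le_prod (fun i _ => Finset.prod_nonneg fun j _ => by positivity) fun i _ => ?_
  rw [← Finset.prod_pow_eq_pow_sum]
  refine Finset.prod_le_prod (fun j _ => by positivity) fun j _ => ?_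
  have := Nat.le_pow_clog one_lt_two ((I.A i j).natAbs + 1)
  rw [Int.abs_eq_natAbs]
  exact_mod_cast this

theorem sum_abs_le (I : IntLO m n) : ∑ i, ∑ j, |I.A i j| ≤ ∏ i, ∏ j, (|I.A i j| + 1) := by
  have h := Matrix.sum_le_prod_add_one (fun q : Fin m × Fin n => |I.A q.1 q.2|)
    fun _ => abs_nonneg _
  rwa [Fintype.sum_prod_type, Fintype.prod_prod_type] at h

/-- With no rows, dual feasibility reads s₀ = c, so every cⱼ is a positive integer and contributes
at least one bit. -/
theorem two_mul_le_inputLength {y₀ : Fin m → ℝ} {s₀ : Fin n → ℝ} (hm : m = 0)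
    (hdual : I.toLO.Aᵀ *ᵥ y₀ + s₀ = I.toLO.c) (hs₀ : ∀ i, 0 < s₀ i) :
    2 * n ≤ I.inputLength := by
  subst hm
  have hc : ∀ j, 1 ≤ Nat.clog 2 ((I.c j).natAbs + 1) := fun j => by
    refine Nat.clog_pos one_lt_two ?_
    have h1 := congrFun hdual j
    have h2 : (0 : ℝ) < I.c j := by
      have h3 : (I.toLO.Aᵀ *ᵥ y₀) j = 0 := by simp [Matrix.mulVec, dotProduct]
      rw [Pi.add_apply, h3, zero_add] at h1
      have := hs₀ j
      rw [h1] at this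
      exact this
    have h4 : 0 < I.c j := by exact_mod_cast h2
    omega
  have h := Finset.card_nsmul_le_sum Finset.univ _ 1 fun j _ => hc j
  simp only [Finset.card_univ, Fintype.card_fin, smul_eq_mul, mul_one] at h
  unfold inputLength
  omega

theorem add_le_inputLength (hm : 0 < m) :
    ∑ i, ∑ j, Nat.clog 2 ((I.A i j).natAbs + 1) + (2 * n + 1) ≤ I.inputLength := by
  have : n ≤ m * n := Nat.le_mul_of_pos_left n hm
  unfold inputLength
  omega

/-- Full rank with m > 0 excludes A = 0. This extra bit raises 2n + 1 to 2n + 2 in the bound on L.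
-/
theorem sum_clog_pos (hA : I.toLO.A.rank = m) (hm : 0 < m) :
    1 ≤ ∑ i, ∑ j, Nat.clog 2 ((I.A i j).natAbs + 1) := by
  by_contra h
  have h0 : I.toLO.A = 0 := by
    ext i j
    have h1 : ∑ i, ∑ j, Nat.clog 2 ((I.A i j).natAbs + 1) = 0 := by omega
    have h2 := (Finset.sum_eq_zero_iff.mp h1) i (Finset.mem_univ i)
    have h3 := (Finset.sum_eq_zero_iff.mp h2) j (Finset.mem_univ j)
    have h4 := Nat.le_pow_clog one_lt_two ((I.A i j).natAbs + 1)
    rw [h3] at h4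
    have h5 : I.A i j = 0 := by
      rw [← Int.natAbs_eq_zero]; omega
    simp [toLO, h5]
  rw [h0, Matrix.rank_zero] at hA
  omega

end IntLO

/-! ### Assembly of the estimates and the choice of parameters -/

namespace IntLO

variable {m n : ℕ} {I : IntLO m n}

/-- The analysis of the algorithm in terms of `Λ = 2 ^ L` and `H = 2 ^ (κ L)`. -/
theorem execution_analysis (hA : I.toLO.A.rank = m) (hn : 0 < n) {θ ε H Λ β D : ℝ}
    {y : ℕ → Fin m → ℝ} {s : ℕ → Fin n → ℝ} {μ : ℕ → ℝ} {dsHat : ℕ → Fin n → ℝ}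
    {dy : ℕ → Fin m → ℝ} {K : ℕ}
    (hβ : (m = 0 ∧ 6 / 5 ≤ β) ∨ 7 * (n : ℝ) ≤ β) (hε : 0 < ε) (hΛ : 4 ≤ Λ) (hH : Λ ≤ H)
    (hεH : ε * (H ^ 3 * Λ ^ 6) ≤ 1) (hK : K * (β ^ 2 + 1) ≤ H * Λ ^ 2) (hβΛ : 13 * n * β ≤ Λ ^ 2)
    (hD : ∀ h : Fin m → Fin n, |(I.toLO.A.submatrix id h).det| ≤ D) (hDΛ : 4 * n ^ 2 * D ≤ Λ)
    (hAH : ∑ i, ∑ j, |I.toLO.A i j| ≤ H ^ 2)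
    (hdual : I.toLO.Aᵀ *ᵥ y 0 + s 0 = I.toLO.c)
    (hs₀ : ∀ i, 1 / H ≤ s 0 i ∧ s 0 i ≤ H) (hμ₀ : 0 < μ 0) (hμH : μ 0 ≤ H)
    (hδ : I.toLO.proximity (s 0) (μ 0) < 1 / 2) (hθ : 0 ≤ θ) (hθ4 : θ ≤ 1 / 4)
    (hθn : θ ^ 2 * n ≤ 1 / 16) (h : I.toLO.IsExecution (1 / Λ ^ 2) θ ε y s μ dsHat dy K) :
    (∀ k ≤ K, IsUnit (I.toLO.newtonMatrix (s k)).det ∧ I.toLO.proximity (s k) (μ k) < 1 / 2 ∧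
      (I.toLO.primalEstimate (s k) (μ k), y k, s k) ∈
        (I.toLO.perturb (I.toLO.perturbation s dsHat dy k)).interiorSet ∧
      l2norm (I.toLO.perturbation s dsHat dy k) ≤ H ^ 3 * Λ ^ 2 * ε) ∧
    (μ K ≤ 1 / Λ ^ 2 →
      (I.toLO.primalEstimate (s K) (μ K), y K, s K) ∈
        (I.toLO.perturb (I.toLO.perturbation s dsHat dy K)).approxOptimalSet (3 / 2 * (1 / Λ ^ 2)) ∧
      {i | s K i < 1 / Λ} = I.toLO.partitionB ∧
      {i | I.toLO.primalEstimate (s K) (μ K) i < 1 / Λ} = I.toLO.partitionN ∧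
      (∃ p, I.toLO.IsRounding (1 / Λ) (I.toLO.primalEstimate (s K) (μ K)) (s K) p) ∧
      ∀ p, I.toLO.IsRounding (1 / Λ) (I.toLO.primalEstimate (s K) (μ K)) (s K) p →
        p ∈ I.toLO.optimalSet) := by
  have hΛ0 : 0 < Λ := by linarith
  have hH0 : 0 < H := by linarith
  have hn1 : (1 : ℝ) ≤ n := by exact_mod_cast hn
  have hs₀p : ∀ i, 0 < s 0 i := fun i => lt_of_lt_of_le (by positivity) (hs₀ i).1
  have hcontrol := h.control hA hn hβ hε hΛ hH hεH hK hβΛ hs₀ hμ₀ hμH hδ hθ hθ4 hθn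
  have hμpos : ∀ k ≤ K, 0 < μ k := fun k hk => by
    rw [h.mu_eq hk]
    exact mul_pos (pow_pos (by linarith) k) hμ₀
  have hμle : ∀ k ≤ K, μ k ≤ μ 0 := fun k hk => by
    rw [h.mu_eq hk]
    exact mul_le_of_le_one_left hμ₀.le (pow_le_one₀ (by linarith) (by linarith))
  have hfeas : ∀ k ≤ K, (I.toLO.primalEstimate (s k) (μ k), y k, s k) ∈
      (I.toLO.perturb (I.toLO.perturbation s dsHat dy k)).interiorSet := fun k hk => by
    obtain ⟨⟨hpos, hprox, -⟩, -⟩ := hcontrol k hk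
    have hx := LO.primalEstimate_pos hpos (hμpos k hk) hprox
    exact ⟨⟨LO.mulVec_primalEstimate hA hpos (hμpos k hk), h.dual_feasible hdual hk,
      fun i => (hx i).le, fun i => (hpos i).le⟩, hx, hpos⟩
  refine ⟨fun k hk => ?_, fun hend => ?_⟩
  · obtain ⟨⟨hpos, hprox, -⟩, hη, hdy⟩ := hcontrol k hk
    refine ⟨LO.isUnit_det_newtonMatrix _ hA hpos, hprox, hfeas k hk, ?_⟩
    refine (LO.l2norm_perturbation_le hA hAH
      (fun j hj => (hcontrol j (by omega)).1.pos) hη hdy).trans ?_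
    have hkK : (k : ℝ) ≤ K := by exact_mod_cast hk
    calc k * (β ^ 2 + 1) * (H ^ 2 * ε) ≤ K * (β ^ 2 + 1) * (H ^ 2 * ε) := by gcongr
      _ ≤ H * Λ ^ 2 * (H ^ 2 * ε) := by gcongr
      _ = _ := by ring
  · obtain ⟨⟨hpos, hprox, ρ, w, hsw, hρ⟩, -⟩ := hcontrol K le_rfl
    have hμK := hμpos K le_rfl
    have hx := LO.primalEstimate_pos hpos hμK hprox
    have hxs := LO.primalEstimate_mul_bounds hpos hμK hprox
    have hρ' : ∀ i, |ρ i| ≤ s 0 i / (H * Λ ^ 4) := fun i =>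
      (hρ i).trans (LO.accumulated_error_le hε hΛ hH hεH hK le_rfl (hs₀ i).1 (hs₀ i).2)
    have hρ10 : ∀ i, |ρ i| ≤ s 0 i / 10 := fun i => by
      refine (hρ' i).trans ?_
      have h1 := hs₀p i
      have h2 : 4 ^ 4 ≤ Λ ^ 4 := by gcongr
      gcongr
      nlinarith
    have hρμ : ∀ {a : ℝ} {i : Fin n}, 0 ≤ a → a * s 0 i ≤ β * μ 0 → a * |ρ i| ≤ μ K / 8 := by
      intro a i ha hai
      -- The starting μ has no lower bound of its own. Without any pass ρ is zero; otherwise the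
      -- last guard and θ ≤ 1/4 give μ K ≥ 3/4 Λ⁻², and 4/3 · 1/13 < 1/8.
      rcases Nat.eq_zero_or_pos K with hK0 | hKpos
      · have h1 := hρ i
        rw [hK0, Nat.cast_zero, zero_mul] at h1
        rw [le_antisymm h1 (abs_nonneg _), mul_zero]
        positivity
      · have hβ13 : 13 * β ≤ Λ ^ 2 := by
          have : 0 ≤ β := by rcases hβ with hβ | hβ <;> linarith
          nlinarith
        have h1 : 3 / 4 * (1 / Λ ^ 2) ≤ μ K := by
          obtain ⟨k, rfl⟩ := Nat.exists_eq_add_of_le' hKpos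
          rw [h.mu_step k (Nat.lt_succ_self k)]
          have := h.guard k (Nat.lt_succ_self k)
          exact mul_le_mul (by linarith) this.le (by positivity) (by linarith)
        have h2 : a * |ρ i| ≤ 1 / 13 * (1 / Λ ^ 2) := by
          calc a * |ρ i| ≤ a * (s 0 i / (H * Λ ^ 4)) := by gcongr; exact hρ' i
            _ = a * s 0 i * (1 / (H * Λ ^ 4)) := by ring
            _ ≤ β * μ 0 * (1 / (H * Λ ^ 4)) := by gcongr
            _ ≤ 1 / 13 * Λ ^ 2 * H * (1 / (H * Λ ^ 4)) := by
              gcongr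
              linarith
            _ = _ := by field_simp
        have h3 : 0 < 1 / Λ ^ 2 := by positivity
        linarith
    have hgap : ∀ p ∈ I.toLO.optimalSet, ∑ i, (I.toLO.primalEstimate (s K) (μ K) i * p.2.2 i +
        p.1 i * s K i) ≤ 7 / 4 * n * μ K := fun p hp =>
      LO.optimality_gap_le hdual (LO.mulVec_primalEstimate hA hpos hμK) hsw (fun i => (hxs i).2) hx
        (fun i => hρμ (hx i).le (LO.iterate_bounds hA hn hs₀p hpos hμK (hμle K le_rfl) hδ hprox hsw
          hρ10 hβ i).2) hp
        fun i => hρμ (hp.1.2.2.1 i) (LO.optimal_primal_bound hA hdual hs₀p hμ₀ hδ hβ hp i)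
    refine ⟨⟨(hfeas K le_rfl).1, ?_⟩, ?_⟩
    · rw [div_le_iff₀ (by linarith)]
      have h1 : I.toLO.primalEstimate (s K) (μ K) ⬝ᵥ s K ≤ ∑ _i : Fin n, 3 / 2 * (1 / Λ ^ 2) :=
        Finset.sum_le_sum fun i _ => (hxs i).2.le.trans (by gcongr)
      refine h1.trans (le_of_eq ?_)
      rw [Finset.sum_const, Finset.card_univ, Fintype.card_fin, nsmul_eq_mul, mul_comm]
    · have hdualK : I.toLO.Aᵀ *ᵥ (y 0 - w) + s K = I.toLO.c + ρ := by
        rw [hsw, Matrix.mulVec_sub, ← hdual]; abel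
      refine rounding_optimal hA hn hdual hs₀p (LO.mulVec_primalEstimate hA hs₀p hμ₀)
        (LO.primalEstimate_pos hs₀p hμ₀ hδ)
        (LO.exists_strictly_complementary hA hn hdual hs₀p hμ₀ hδ)
        (LO.mulVec_primalEstimate hA hpos hμK) hx hpos hdualK hμK hΛ
        (by rwa [le_div_iff₀ (by positivity)] at hend) (fun i => ?_) (fun i => (hxs i).1) hgap hD
        hDΛ
      refine (hρ' i).trans ?_
      rw [div_le_div_iff₀ (by positivity) (by positivity), one_mul]
      have := (hs₀ i).2
      gcongr

/-- The slack in the input length dominates the subdeterminants and powers of the dimension. -/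
theorem exists_size_parameters (hA : I.toLO.A.rank = m) (hn : 0 < n) {y₀ : Fin m → ℝ}
    {s₀ : Fin n → ℝ} (hdual : I.toLO.Aᵀ *ᵥ y₀ + s₀ = I.toLO.c) (hs₀ : ∀ i, 0 < s₀ i) :
    ∃ β D : ℝ, ((β = 6 / 5 ∧ 2 * n ≤ I.inputLength) ∨
        (β = 7 * n ∧ 2 * n + 2 ≤ I.inputLength)) ∧
      ((m = 0 ∧ 6 / 5 ≤ β) ∨ 7 * (n : ℝ) ≤ β) ∧
      (∀ h : Fin m → Fin n, |(I.toLO.A.submatrix id h).det| ≤ D) ∧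
      4 * (n : ℝ) ^ 2 * D ≤ 2 ^ I.inputLength ∧ ∑ i, ∑ j, |I.toLO.A i j| ≤ D ∧
      13 * n * β ≤ ((2 : ℝ) ^ I.inputLength) ^ 2 := by
  have hn1 : (1 : ℝ) ≤ n := by exact_mod_cast hn
  have h2n := two_mul_le_two_pow hn
  have h4n : 4 * (n : ℝ) ^ 2 ≤ 2 ^ (2 * n) := by
    calc 4 * (n : ℝ) ^ 2 = (2 * n) ^ 2 := by ring
      _ ≤ (2 ^ n) ^ 2 := by gcongr
      _ = 2 ^ (2 * n) := by rw [← pow_mul, mul_comm]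
  have hdet : ∀ h : Fin m → Fin n, |(I.toLO.A.submatrix id h).det| ≤
      ((∏ i, ∏ j, (|I.A i j| + 1) : ℤ) : ℝ) := fun h => by
    rw [IntLO.det_submatrix_toLO, ← Int.cast_abs, Int.cast_le]
    exact Matrix.abs_det_submatrix_le I.A h
  have hsum : ∑ i, ∑ j, |I.toLO.A i j| ≤ ((∏ i, ∏ j, (|I.A i j| + 1) : ℤ) : ℝ) := by
    have : ∑ i, ∑ j, |I.toLO.A i j| = ((∑ i, ∑ j, |I.A i j| : ℤ) : ℝ) := by
      push_cast
      rfl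
    rw [this, Int.cast_le]
    exact I.sum_abs_le
  have hprod : ((∏ i, ∏ j, (|I.A i j| + 1) : ℤ) : ℝ) ≤
      2 ^ (∑ i, ∑ j, Nat.clog 2 ((I.A i j).natAbs + 1)) := by
    exact_mod_cast I.prod_add_one_le
  rcases Nat.eq_zero_or_pos m with hm | hm
  · have hℓ := IntLO.two_mul_le_inputLength hm hdual hs₀
    have hΛ : 4 * (n : ℝ) ^ 2 ≤ 2 ^ I.inputLength := h4n.trans (pow_le_pow_right₀ one_le_two hℓ)
    -- For n = 1 and L = 2 the last requirement reads 15.6 ≤ 16, so β is chosen close to its limit.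
    refine ⟨6 / 5, _, Or.inl ⟨rfl, hℓ⟩, Or.inl ⟨hm, le_rfl⟩, hdet, ?_, hsum, ?_⟩
    · subst hm
      simpa using hΛ
    · have : (4 * (n : ℝ) ^ 2) ^ 2 ≤ (2 ^ I.inputLength) ^ 2 := by gcongr
      have h3 : (n : ℝ) ≤ n ^ 4 := le_self_pow₀ hn1 (by norm_num)
      nlinarith
  · have hℓ := IntLO.add_le_inputLength (I := I) hm
    have hA1 := IntLO.sum_clog_pos hA hm
    have hΛ : 16 * (n : ℝ) ^ 2 ≤ 2 ^ I.inputLength := by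
      calc 16 * (n : ℝ) ^ 2 ≤ 2 ^ (2 * n) * 2 ^ 2 := by linarith
        _ = 2 ^ (2 * n + 2) := by rw [pow_add]
        _ ≤ 2 ^ I.inputLength := pow_le_pow_right₀ one_le_two (by omega)
    refine ⟨7 * n, _, Or.inr ⟨rfl, by omega⟩, Or.inr le_rfl, hdet, ?_, hsum, ?_⟩
    · calc 4 * (n : ℝ) ^ 2 * ((∏ i, ∏ j, (|I.A i j| + 1) : ℤ) : ℝ)
          ≤ 2 ^ (2 * n) * 2 ^ (∑ i, ∑ j, Nat.clog 2 ((I.A i j).natAbs + 1)) := by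
            refine mul_le_mul h4n hprod ?_ (by positivity)
            exact (abs_nonneg _).trans (hdet fun _ => ⟨0, hn⟩)
        _ = 2 ^ (2 * n + ∑ i, ∑ j, Nat.clog 2 ((I.A i j).natAbs + 1)) := by rw [pow_add]
        _ ≤ 2 ^ I.inputLength := pow_le_pow_right₀ one_le_two (by omega)
    · have : (16 * (n : ℝ) ^ 2) ^ 2 ≤ (2 ^ I.inputLength) ^ 2 := by gcongr
      have h3 : (n : ℝ) ^ 2 ≤ n ^ 4 := pow_le_pow_right₀ hn1 (by norm_num)
      nlinarith

end IntLO

theorem mainTheorem1 (κ : ℝ) (hκ : 1 ≤ κ) :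
    ∃ C : ℝ, 0 < C ∧
      ∀ t : ℝ, 3 * κ + 6 ≤ t →
      ∀ (m n : ℕ), 0 < n →
      ∀ I : IntLO m n, I.toLO.A.rank = m →
      ∀ (θ : ℝ), 1 / (4 * κ * √n) ≤ θ → θ ≤ 1 / (4 * √n) →
      ∀ (y : ℕ → Fin m → ℝ) (s : ℕ → Fin n → ℝ) (μ : ℕ → ℝ)
        (dsHat : ℕ → Fin n → ℝ) (dy : ℕ → Fin m → ℝ) (K : ℕ),
        I.toLO.Aᵀ *ᵥ y 0 + s 0 = I.toLO.c →
        (∀ i, (2 : ℝ) ^ (-(κ * I.inputLength)) ≤ s 0 i ∧ s 0 i ≤ (2 : ℝ) ^ (κ * I.inputLength)) →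
        0 < μ 0 → μ 0 ≤ (2 : ℝ) ^ (κ * I.inputLength) →
        I.toLO.proximity (s 0) (μ 0) < 1 / 2 →
        I.toLO.IsExecution ((2 : ℝ) ^ (-(2 * I.inputLength : ℝ))) θ
          ((2 : ℝ) ^ (-(t * I.inputLength))) y s μ dsHat dy K →
        (K : ℝ) ≤ C * √n * I.inputLength ∧
        (∀ k ≤ K,
          IsUnit (I.toLO.newtonMatrix (s k)).det ∧
          I.toLO.proximity (s k) (μ k) < 1 / 2 ∧
          (I.toLO.primalEstimate (s k) (μ k), y k, s k) ∈
            (I.toLO.perturb (I.toLO.perturbation s dsHat dy k)).interiorSet ∧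
          l2norm (I.toLO.perturbation s dsHat dy k) ≤
            (2 : ℝ) ^ ((3 * κ + 2 - t) * I.inputLength)) ∧
        (μ K ≤ (2 : ℝ) ^ (-(2 * I.inputLength : ℝ)) →
          (I.toLO.primalEstimate (s K) (μ K), y K, s K) ∈
            (I.toLO.perturb (I.toLO.perturbation s dsHat dy K)).approxOptimalSet
              (3 / 2 * (2 : ℝ) ^ (-(2 * I.inputLength : ℝ))) ∧
          {i | s K i < (2 : ℝ) ^ (-(I.inputLength : ℝ))} = I.toLO.partitionB ∧
          {i | I.toLO.primalEstimate (s K) (μ K) i < (2 : ℝ) ^ (-(I.inputLength : ℝ))}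
            = I.toLO.partitionN ∧
          (∃ p, I.toLO.IsRounding ((2 : ℝ) ^ (-(I.inputLength : ℝ)))
            (I.toLO.primalEstimate (s K) (μ K)) (s K) p) ∧
          ∀ p, I.toLO.IsRounding ((2 : ℝ) ^ (-(I.inputLength : ℝ)))
            (I.toLO.primalEstimate (s K) (μ K)) (s K) p → p ∈ I.toLO.optimalSet) := by
  -- The additive 1 of the iteration count is absorbed because √n L ≥ 1.
  refine ⟨1 + 14 / 5 * (κ * (κ + 2)), by positivity, ?_⟩
  intro t ht m n hn I hA θ hθl hθu y s μ dsHat dy K hdual hs₀ hμ₀ hμH hδ hrun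
  set ℓ := I.inputLength with hℓdef
  have hn1 : (1 : ℝ) ≤ n := by exact_mod_cast hn
  have hsqrt1 : 1 ≤ √(n : ℝ) := Real.one_le_sqrt.mpr hn1
  have hsqrt0 : 0 < √(n : ℝ) := by linarith
  have hθ0 : 0 < θ := lt_of_lt_of_le (by positivity) hθl
  have hθs : θ * √n ≤ 1 / 4 := by
    rw [le_div_iff₀ (by positivity)] at hθu
    linarith
  have hθ4 : θ ≤ 1 / 4 := by nlinarith
  have hθn : θ ^ 2 * n ≤ 1 / 16 := by
    have h1 : θ ^ 2 * n = (θ * √n) ^ 2 := by rw [mul_pow, Real.sq_sqrt (by linarith)]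
    rw [h1]
    have : (θ * √n) ^ 2 ≤ (1 / 4) ^ 2 := by gcongr
    linarith
  have hs₀p : ∀ i, 0 < s 0 i := fun i => lt_of_lt_of_le (by positivity) (hs₀ i).1
  obtain ⟨β, D, hβℓ, hβ, hD, hDℓ, hAD, hβΛ⟩ := IntLO.exists_size_parameters hA hn hdual hs₀p
  rw [← hℓdef] at hβℓ hDℓ hβΛ
  have hℓ2 : 2 ≤ ℓ := by omega
  have hℓ1 : (1 : ℝ) ≤ ℓ := by exact_mod_cast (by omega : 1 ≤ ℓ)
  set Λ : ℝ := 2 ^ (ℓ : ℝ) with hΛdef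
  set H : ℝ := 2 ^ (κ * ℓ) with hHdef
  have hΛpow : Λ = 2 ^ ℓ := Real.rpow_natCast _ _
  have hΛ4 : 4 ≤ Λ := by
    rw [hΛpow]
    calc (4 : ℝ) = 2 ^ 2 := by norm_num
      _ ≤ 2 ^ ℓ := pow_le_pow_right₀ one_le_two hℓ2
  have hΛH : Λ ≤ H := Real.rpow_le_rpow_of_exponent_le one_le_two (by nlinarith)
  have hτ : (2 : ℝ) ^ (-(2 * ℓ : ℝ)) = 1 / Λ ^ 2 := by
    rw [Real.rpow_neg zero_le_two, one_div, hΛdef, ← Real.rpow_natCast, ← Real.rpow_mul zero_le_two]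
    congr 2
    push_cast
    ring
  have hτ1 : (2 : ℝ) ^ (-(ℓ : ℝ)) = 1 / Λ := by rw [Real.rpow_neg zero_le_two, one_div]
  have hHinv : (2 : ℝ) ^ (-(κ * ℓ)) = 1 / H := by rw [Real.rpow_neg zero_le_two, one_div]
  -- The case a = 6 is the smallness condition, met by t ≥ 3κ + 6; the case a = 2 is the bound on
  -- the accumulated perturbation.
  have hcube : ∀ a : ℕ, (2 : ℝ) ^ (-(t * ℓ)) * (H ^ 3 * Λ ^ a) = 2 ^ ((3 * κ + a - t) * ℓ) := by
    intro a
    rw [hΛdef, hHdef, ← Real.rpow_natCast, ← Real.rpow_natCast, ← Real.rpow_mul zero_le_two,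
      ← Real.rpow_mul zero_le_two, ← Real.rpow_add two_pos, ← Real.rpow_add two_pos]
    congr 1
    push_cast
    ring
  have hcount : (K : ℝ) ≤ 1 + 14 / 5 * (κ * (κ + 2)) * (√n * ℓ) := by
    refine iteration_count_le hκ hsqrt0 (by linarith) hμ₀ hμH hθl (by linarith) fun k hk => ?_
    rw [← hrun.mu_eq hk.le]
    exact hrun.guard k hk
  have hKβ := iteration_count_mul_le hκ hn hβℓ hcount
  rw [hτ] at hrun
  rw [hHinv] at hs₀
  have hmain := IntLO.execution_analysis hA hn hβ (by positivity) hΛ4 hΛH (by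
      rw [hcube]
      refine Real.rpow_le_one_of_one_le_of_nonpos one_le_two ?_
      push_cast
      nlinarith) hKβ (by rw [hΛpow]; exact hβΛ) hD (by rw [hΛpow]; exact hDℓ) (by
      refine hAD.trans ?_
      have hD0 : 0 ≤ D := (abs_nonneg _).trans (hD fun _ => ⟨0, hn⟩)
      have h1 : D ≤ Λ := by
        rw [hΛpow]
        exact le_trans (le_mul_of_one_le_left hD0 (by nlinarith)) hDℓ
      nlinarith) hdual hs₀ hμ₀ hμH hδ hθ0.le hθ4 hθn hrun
  rw [hτ, hτ1]
  refine ⟨?_, fun k hk => ?_, hmain.2⟩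
  · have : 1 ≤ √(n : ℝ) * ℓ := one_le_mul_of_one_le_of_one_le hsqrt1 hℓ1
    linarith
  · obtain ⟨h1, h2, h3, h4⟩ := hmain.1 k hk
    refine ⟨h1, h2, h3, h4.trans (le_of_eq ?_)⟩
    have := hcube 2
    push_cast at this
    rw [← this]
    ring
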